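/- **Setting.** An MDP has a measurable subset $\mathcal S$ of a Euclidean space as state space, a finite nonempty action set $\mathcal A$, an initial state $s_1$, and kernels $Q_a(\cdot\mid s)$, the joint law of reward and next state. $\mathcal S_1=\{s_1\}$, and $\mathcal S_{h+1}$ is the union over $s\in\mathcal S_h$, $a\in\mathcal A$ of the supports of the next-state laws. The class $\mathcal M_{H,d}$ consists of the pairs $(M,\varphi)$ of an MDP $M$ with horizon $H$ and rewards in $[0,1]$ almost surely, and measurable feature maps $\varphi_h:\mathcal S\times\mathcal A\to\mathbb R^d$, for which some $\theta^\star\in\mathbb R^d$ satisfies $q^\star_h(s,a)=\langle\varphi_h(s,a),\theta^\star\rangle$ for all $h\in[H]$, $(s,a)\in\mathcal S_h\times\mathcal A$, where $q^\star,v^\star$ are the optimal value functions. We consider those $(M,\varphi)\in\mathcal M_{H,d}$ for which every set $\{\varphi_h(s,a):(s,a)\in\mathcal S_h\times\mathcal A\}$, $h\in[H]$, is compact. **Planners.** A local planner knows $\mathcal S$, $\mathcal A$, the sets $\mathcal S_h$ and $\varphi$. Given a stage $h$ and a state $s\in\mathcal S_h$, it queries a simulator (a query $(s',a')$ is answered by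 a draw from $Q_{a'}(\cdot\mid s')$), stops after a number $N$ of queries, and returns an action; the law of that action is $\pi_h(\cdot\mid s)$. It is $\delta$-sound if it stops almost surely and $\sup_{h\in[H],\,s\in\mathcal S_h}(v^\star_h(s)-v^\pi_h(s))\le\delta$ for all $(M,\varphi)$ considered. Its query cost is the supremum of $\mathbb E[N]$ over all $(M,\varphi)$ considered, $h\in[H]$ and $s\in\mathcal S_h$. A global planner queries once, without being given $h$ and $s$, and then returns a (data-dependent) policy $\hat\pi$ for all stages and states. It is globally $\delta$-sound if, for all $(M,\varphi)$ considered, its gap $\sup_{h\in[H],\,s\in\mathcal S_h}(v^\star_h(s)-v^{\hat\pi}_h(s))$ has (upper) expectation at most $\delta$, and is at most $\delta$ with probability at least $1-\delta/2$. **Algorithm.** For a finitely supported distribution $\rho$ on $\mathcal S_h\times\mathcal A$ let $G(\rho)=\sum_z\rho(z)\varphi_h(z)\varphi_h(z)^\top$. Call $\rho$ a near-optimal $G$-experimental design with constant $K$ if it has at most $K(4d\log\log d+16)$ support points (with $\log\log 1:=0$), the features of the support points span those of all $z\in\mathcal S_h\times\mathcal A$, and $\varphi_h(z)^\top G(\rho)^{\dagger}\varphi_h(z)\le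 2d$ for all $z\in\mathcal S_h\times\mathcal A$, where $\dagger$ is the Moore–Penrose inverse. Least-squares value iteration with $n$ samples per design point chooses, from what the planner knows, such a design $\rho_h$ for each $h\in[H]$, sets $f_{H+1}=0$, and for $h=H,\dots,1$ draws for each $z=(s,a)\in\operatorname{supp}\rho_h$ samples $(R_i(z),S_i'(z))\sim Q_a(\cdot\mid s)$, $i\le n$, and sets $$\hat\mu_h(z)=\frac1n\sum_{i=1}^n\Big(R_i(z)+\max_{a'}f_{h+1}(S_i'(z),a')\Big),\qquad \hat\theta_h=G(\rho_h)^\dagger\sum_z\rho_h(z)\hat\mu_h(z)\varphi_h(z),$$ $$f_h(s,a)=\max(\min(\langle\varphi_h(s,a),\hat\theta_h\rangle,H),-H).$$ The planner then acts greedily with respect to $(f_h)$, with any measurable tie-breaking. **Proposition.** There are absolute constants $K\ge1$ and $C_1,C_2>0$ such that the following holds for all integers $H,d\ge1$. Near-optimal $G$-experimental designs with constant $K$ exist for all $(M,\varphi)$ considered and all $h\in[H]$. For every choice of such designs and every $\delta>0$, with $$n=\left\lceil C_1\,\frac{H^4(2d)^H}{\delta^2}\,\log\!\Big(2+\frac{Hd}{\delta}\Big)\right\rceil$$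 the planner is $\delta$-sound as a local planner (running the algorithm afresh in each call) and globally $\delta$-sound (running it once). If moreover $\delta\le H$, its query cost is at most $$C_2\,\frac{H^5(2d)^{H+1}}{\delta^2}\,\log^2\!\Big(2+\frac{Hd}{\delta}\Big).$$ -/

import Mathlib

open MeasureTheory ProbabilityTheory
open scoped ENNReal Matrix

noncomputable section

namespace QPlanning

/-! ### Markov decision processes

Stages are numbered from `0`: stage `h` here (with `h < H`) is the `(h + 1)`-st stage of an episode
of length `H`. -/

/-- A Markov decision process with initial state `init`; `Q (s, a)` is the joint law of the reward
and the next state when action `a` is taken in state `s`. -/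
structure MDP (S A : Type) [MeasurableSpace S] [MeasurableSpace A] where
  init : S
  Q : Kernel (S × A) (ℝ × S)
  markov : IsMarkovKernel Q

attribute [instance] MDP.markov

namespace MDP

variable {S A : Type} [MeasurableSpace S] [MeasurableSpace A]

/-- The expected immediate reward `r_a(s)`. -/
def reward (M : MDP S A) (s : S) (a : A) : ℝ := ∫ x, x.1 ∂(M.Q (s, a))

/-- The law `P_a(· | s)` of the next state. -/
def next (M : MDP S A) (s : S) (a : A) : Measure S := (M.Q (s, a)).map Prod.snd

/-- `M.reach h`: the states accessible from the initial state in `h` steps. -/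
def reach [TopologicalSpace S] (M : MDP S A) : ℕ → Set S
  | 0 => {M.init}
  | h + 1 => {s' | ∃ a : A, ∃ s ∈ M.reach h, s' ∈ (M.next s a).support}

/-- Optimal action values with `j` steps to go, by the Bellman optimality equations. -/
def optQ (M : MDP S A) : ℕ → S → A → ℝ
  | 0 => fun _ _ => 0
  | j + 1 => fun s a => M.reward s a + ∫ s', (⨆ a', M.optQ j s' a') ∂(M.next s a)

/-- `q^⋆_h(s, a)` for horizon `H`. -/
def qStar (M : MDP S A) (H h : ℕ) (s : S) (a : A) : ℝ := M.optQ (H - h) s a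

/-- `v^⋆_h(s) = max_a q^⋆_h(s, a)` for horizon `H`. -/
def vStar (M : MDP S A) (H h : ℕ) (s : S) : ℝ := ⨆ a, M.qStar H h s a

/-- `M.polValue π j h s`: the expected total reward of the memoryless policy `π` over `j` steps when
started at stage `h` in state `s`; `π h s a` is the probability of action `a`. -/
def polValue [Fintype A] (M : MDP S A) (π : ℕ → S → A → ℝ) : ℕ → ℕ → S → ℝ
  | 0, _, _ => 0
  | j + 1, h, s =>
      ∑ a, π h s a * (M.reward s a + ∫ s', M.polValue π j (h + 1) s' ∂(M.next s a))

/-- The value function `v^π_h(s)` for horizon `H`. -/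
def vPol [Fintype A] (M : MDP S A) (H : ℕ) (π : ℕ → S → A → ℝ) (h : ℕ) (s : S) : ℝ :=
  M.polValue π (H - h) h s

/-- The suboptimality gap `δ^π`, the supremum of `v^⋆_h(s) - v^π_h(s)` over all stages `h` and all
states `s` accessible at stage `h`. -/
def suboptimality [Fintype A] [TopologicalSpace S] (M : MDP S A) (H : ℕ)
    (π : ℕ → S → A → ℝ) : ℝ≥0∞ :=
  ⨆ (h : ℕ) (_ : h < H) (s : S) (_ : s ∈ M.reach h),
    ENNReal.ofReal (M.vStar H h s - M.vPol H π h s)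

end MDP

/-! ### Planning problems -/

/-- What a planner is told about the problem: the state space (a measurable subset of a Euclidean
space), the finite nonempty action set, the initial state, the sets of states of the individual
stages, and the `d`-dimensional feature map of each stage. -/
structure PlanningInput (d : ℕ) where
  dim : ℕ
  stateSet : Set (EuclideanSpace ℝ (Fin dim))
  measurableSet_stateSet : MeasurableSet stateSet
  actionsPred : ℕ
  init : stateSet
  stage : ℕ → Set stateSet
  feature : ℕ → stateSet × Fin (actionsPred + 1) → Fin d → ℝ
  measurable_feature : ∀ h, Measurable (feature h)

namespace PlanningInput

abbrev State {d : ℕ} (I : PlanningInput d) : Type := I.stateSet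

abbrev Action {d : ℕ} (I : PlanningInput d) : Type := Fin (I.actionsPred + 1)

/-- The state-action pairs of stage `h`. -/
def pairs {d : ℕ} (I : PlanningInput d) (h : ℕ) : Set (I.State × I.Action) :=
  {z | z.1 ∈ I.stage h}

end PlanningInput

/-- The class `M_{H,d}`: pairs of an MDP with horizon `H` and rewards in `[0, 1]` and a
`d`-dimensional feature map that realizes the optimal action-value function of the MDP. -/
structure Problem (H d : ℕ) where
  input : PlanningInput d
  mdp : MDP input.State input.Action
  init_eq : mdp.init = input.init
  stage_eq : ∀ h ≤ H, input.stage h = mdp.reach h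
  bounded : ∀ z, ∀ᵐ x ∂(mdp.Q z), x.1 ∈ Set.Icc (0 : ℝ) 1
  realizable : ∃ θ : Fin d → ℝ, ∀ h < H, ∀ z ∈ input.pairs h,
    mdp.qStar H h z.1 z.2 = input.feature h z ⬝ᵥ θ

/-- The problems in `M_{H,d}` whose sets of feature vectors are compact at every stage. -/
def compactProblems (H d : ℕ) : Set (Problem H d) :=
  {X | ∀ h < H, IsCompact (X.input.feature h '' X.input.pairs h)}

/-! ### Interaction of a planner with the simulator -/

/-- One round of interaction: the query, the simulator's answer (reward and next state), and the
decision whether to continue. -/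
abbrev Step (S A : Type) : Type := ((S × A) × (ℝ × S)) × Bool

/-- A possibly adaptive and randomized way to query the simulator. After `t` rounds the next query is
drawn from `query t`; once it has been answered, `cont t` decides whether to continue. -/
structure Sampler (S A : Type) [MeasurableSpace S] [MeasurableSpace A] where
  query : (t : ℕ) → Kernel (Fin t → Step S A) (S × A)
  cont : (t : ℕ) → Kernel ((Fin t → Step S A) × ((S × A) × (ℝ × S))) Bool
  markov_query : ∀ t, IsMarkovKernel (query t)
  markov_cont : ∀ t, IsMarkovKernel (cont t)

attribute [instance] Sampler.markov_query Sampler.markov_cont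

namespace Sampler

variable {S A : Type} [MeasurableSpace S] [MeasurableSpace A]

/-- The law of the next round given the first `t` rounds. -/
def stepKernel (σ : Sampler S A) (M : MDP S A) (t : ℕ) :
    Kernel (Fin t → Step S A) (Step S A) :=
  (σ.query t ⊗ₖ Kernel.prodMkLeft (Fin t → Step S A) M.Q) ⊗ₖ σ.cont t

instance (σ : Sampler S A) (M : MDP S A) (t : ℕ) : IsMarkovKernel (σ.stepKernel M t) := by
  unfold stepKernel; infer_instance

/-- A history indexed by `Finset.Iic m`, reindexed by `Fin (m + 1)`. -/
def reindex (m : ℕ) (x : (i : Finset.Iic m) → Step S A) : Fin (m + 1) → Step S A :=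
  fun i => x ⟨i, Finset.mem_Iic.2 (Nat.lt_succ_iff.1 i.2)⟩

theorem measurable_reindex (m : ℕ) : Measurable (reindex (S := S) (A := A) m) :=
  measurable_pi_lambda _ fun _ => measurable_pi_apply _

/-- The law of the infinite sequence of rounds (Ionescu-Tulcea). -/
def run (σ : Sampler S A) (M : MDP S A) : Measure (ℕ → Step S A) :=
  Measure.bind
    ((σ.stepKernel M 0 Fin.elim0).map fun x => (fun _ => x : (i : Finset.Iic 0) → Step S A))
    (Kernel.traj (X := fun _ => Step S A)
      (fun m => (σ.stepKernel M (m + 1)).comap (reindex m) (measurable_reindex m)) 0)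

end Sampler

/-- The first `t` rounds. -/
def firstRounds {S A : Type} (t : ℕ) (ω : ℕ → Step S A) : Fin t → Step S A := fun i => ω i

/-- Querying stops right after round `t` (rounds being numbered from `0`). -/
def StopsAt {S A : Type} (ω : ℕ → Step S A) (t : ℕ) : Prop :=
  (ω t).2 = false ∧ ∀ i < t, (ω i).2 = true

/-- The number of queries (`∞` if querying never stops). -/
def numQueries {S A : Type} (ω : ℕ → Step S A) : ℝ≥0∞ :=
  ⨅ (t : ℕ) (_ : StopsAt ω t), ((t + 1 : ℕ) : ℝ≥0∞)

/-- A sampler together with the law of the action returned when querying stops. -/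
structure Strategy (S A : Type) [MeasurableSpace S] [MeasurableSpace A] extends Sampler S A where
  output : (t : ℕ) → Kernel (Fin t → Step S A) A
  markov_output : ∀ t, IsMarkovKernel (output t)

open Classical in
/-- The probability that the strategy returns the action `a`. -/
def Strategy.actionProb {S A : Type} [MeasurableSpace S] [MeasurableSpace A] (σ : Strategy S A)
    (M : MDP S A) (a : A) : ℝ≥0∞ :=
  ∫⁻ ω, ∑' t, (if StopsAt ω t then σ.output (t + 1) (firstRounds (t + 1) ω) {a} else 0)
    ∂(σ.toSampler.run M)

/-- A (local) planner: given what it is told about the problem, a stage and an input state, it queries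
the simulator and returns an action. -/
abbrev Planner (d : ℕ) : Type :=
  (I : PlanningInput d) → ℕ → I.State → Strategy I.State I.Action

namespace Planner

variable {H d : ℕ}

/-- The memoryless policy implemented by the planner. -/
def policy (P : Planner d) (X : Problem H d) (h : ℕ) (s : X.input.State) (a : X.input.Action) : ℝ :=
  ((P X.input h s).actionProb X.mdp a).toReal

/-- `δ`-soundness on a class of problems: the planner stops almost surely, and the policy that it
implements is a probability kernel at every stage, with suboptimality gap at most `δ`. -/
structure IsSound (P : Planner d) (𝓜 : Set (Problem H d)) (δ : ℝ) : Prop where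
  wellFormed : ∀ X ∈ 𝓜, ∀ h < H, ∀ s ∈ X.input.stage h,
    ∀ᵐ ω ∂((P X.input h s).toSampler.run X.mdp), ∃ t, StopsAt ω t
  measurable : ∀ X ∈ 𝓜, ∀ h < H, ∀ a, Measurable fun s => P.policy X h s a
  subopt_le : ∀ X ∈ 𝓜, X.mdp.suboptimality H (P.policy X) ≤ ENNReal.ofReal δ

/-- The query cost: the worst-case expected number of queries. -/
def queryCost (P : Planner d) (𝓜 : Set (Problem H d)) : ℝ≥0∞ :=
  ⨆ (X : Problem H d) (_ : X ∈ 𝓜) (h : ℕ) (_ : h < H) (s : X.input.State)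
    (_ : s ∈ X.input.stage h), ∫⁻ ω, numQueries ω ∂((P X.input h s).toSampler.run X.mdp)

end Planner

/-- A global planner: it queries the simulator without being given a stage or a state, and what it has
seen when it stops determines an action for every stage and every state. -/
structure GlobalPlanner (d : ℕ) where
  sampler : (I : PlanningInput d) → Sampler I.State I.Action
  readout : (I : PlanningInput d) → (t : ℕ) → (Fin t → Step I.State I.Action) →
    ℕ → I.State → I.Action
  measurable_readout : ∀ I t h, Measurable fun p : (Fin t → Step I.State I.Action) × I.State =>
    readout I t p.1 h p.2

namespace GlobalPlanner

variable {H d : ℕ}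

/-- The local planner that runs the global planner afresh in every call. -/
def toPlanner (G : GlobalPlanner d) : Planner d := fun I h s =>
  { G.sampler I with
    output := fun t => Kernel.deterministic (fun y => G.readout I t y h s)
      ((G.measurable_readout I t h).comp (measurable_id.prodMk measurable_const))
    markov_output := fun _ => inferInstance }

open Classical in
/-- The suboptimality gap of the policy that is read out in the run `ω` (`∞` if the run never
stops). -/
def gap (G : GlobalPlanner d) (X : Problem H d)
    (ω : ℕ → Step X.input.State X.input.Action) : ℝ≥0∞ :=
  ⨅ (t : ℕ) (_ : StopsAt ω t), X.mdp.suboptimality H fun h s a =>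
    if G.readout X.input (t + 1) (firstRounds (t + 1) ω) h s = a then 1 else 0

/-- Global `δ`-soundness on a class of problems: one run almost surely stops, and the policy that is
read out, which is then used at all stages and in all states, has a suboptimality gap whose
expectation is at most `δ` (`b` takes care of measurability) and which itself is at most `δ` with
probability at least `1 - δ / 2`. -/
structure IsGloballySound (G : GlobalPlanner d) (𝓜 : Set (Problem H d)) (δ : ℝ) : Prop where
  wellFormed : ∀ X ∈ 𝓜, ∀ᵐ ω ∂((G.sampler X.input).run X.mdp), ∃ t, StopsAt ω t
  expected : ∀ X ∈ 𝓜, ∃ b : (ℕ → Step X.input.State X.input.Action) → ℝ≥0∞,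
    Measurable b ∧ (∀ ω, G.gap X ω ≤ b ω) ∧
      ∫⁻ ω, b ω ∂((G.sampler X.input).run X.mdp) ≤ ENNReal.ofReal δ
  highProb : ∀ X ∈ 𝓜,
    (G.sampler X.input).run X.mdp {ω | ENNReal.ofReal δ < G.gap X ω} ≤ ENNReal.ofReal (δ / 2)

end GlobalPlanner

/-! ### Experimental designs and least squares -/

/-- The design matrix `G(ρ) = ∑_z ρ(z) φ(z) φ(z)ᵀ`. -/
def designMatrix {d : ℕ} {Z : Type} (φ : Z → Fin d → ℝ) (ρ : Z →₀ ℝ) : Matrix (Fin d) (Fin d) ℝ :=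
  ∑ z ∈ ρ.support, ρ z • Matrix.vecMulVec (φ z) (φ z)

/-- The Moore-Penrose inverse of a symmetric matrix: nonzero eigenvalues are inverted and the
eigenvalue `0` is kept (`0⁻¹ = 0`). It is the inverse of the matrix if the matrix is invertible. -/
def symmPinv {d : ℕ} (G : Matrix (Fin d) (Fin d) ℝ) : Matrix (Fin d) (Fin d) ℝ :=
  cfc (fun x : ℝ => x⁻¹) G

/-- The least-squares estimator for the design `ρ` and the observations `r`. -/
def lsEstimator {d : ℕ} {Z : Type} (φ : Z → Fin d → ℝ) (ρ : Z →₀ ℝ) (r : Z → ℝ) : Fin d → ℝ :=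
  symmPinv (designMatrix φ ρ) *ᵥ ∑ z ∈ ρ.support, (ρ z * r z) • φ z

/-- A near-optimal `G`-experimental design on `Z₀`: a probability distribution on `Z₀` with at most
`K (4 d log log d + 16)` support points for which `φ(z)ᵀ G(ρ)⁻¹ φ(z) ≤ 2 d` on `Z₀`. The features
need not span the whole space, hence the pseudo-inverse and the condition that the features of the
support points span all features. -/
structure IsNearOptimalDesign {d : ℕ} {Z : Type} (K : ℝ) (φ : Z → Fin d → ℝ) (Z₀ : Set Z)
    (ρ : Z →₀ ℝ) : Prop where
  support_subset : ↑ρ.support ⊆ Z₀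
  nonneg : ∀ z, 0 ≤ ρ z
  sum_eq_one : ∑ z ∈ ρ.support, ρ z = 1
  card_le : (ρ.support.card : ℝ) ≤ K * (4 * d * Real.log (Real.log d) + 16)
  mem_span : ∀ z ∈ Z₀, φ z ∈ Submodule.span ℝ (φ '' ↑ρ.support)
  variance_le : ∀ z ∈ Z₀, φ z ⬝ᵥ (symmPinv (designMatrix φ ρ) *ᵥ φ z) ≤ 2 * d

/-- A rule that selects a design for every stage from what the planner is told. -/
abbrev DesignRule (d : ℕ) : Type :=
  (I : PlanningInput d) → ℕ → (I.State × I.Action →₀ ℝ)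

/-- The rule selects near-optimal designs (with constant `K`) in all problems with compact sets of
feature vectors. -/
def DesignRule.IsNearOptimal {d : ℕ} (D : DesignRule d) (K : ℝ) (H : ℕ) : Prop :=
  ∀ X ∈ compactProblems H d, ∀ h < H,
    IsNearOptimalDesign K (X.input.feature h) (X.input.pairs h) (D X.input h)

/-! ### Least-squares value iteration -/

/-- A greedy choice among finitely many actions, with arbitrary (measurable) tie-breaking. -/
structure ArgmaxRule where
  choose : (k : ℕ) → (Fin (k + 1) → ℝ) → Fin (k + 1)
  isMax : ∀ (k : ℕ) (x : Fin (k + 1) → ℝ) (i : Fin (k + 1)), x i ≤ x (choose k x)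
  measurable_choose : ∀ k, Measurable (choose k)

/-- Greedy choices exist: take the first maximizer. -/
theorem ArgmaxRule.nonempty : Nonempty ArgmaxRule := by
  classical
  have hne : ∀ (k : ℕ) (x : Fin (k + 1) → ℝ),
      (Finset.univ.filter fun i => ∀ j, x j ≤ x i).Nonempty := by
    intro k x
    obtain ⟨i, hi⟩ := Finite.exists_max x
    exact ⟨i, by simpa using hi⟩
  refine ⟨⟨fun k x => (Finset.univ.filter fun i => ∀ j, x j ≤ x i).min' (hne k x), ?_, ?_⟩⟩
  · intro k x i
    have h := Finset.min'_mem _ (hne k x)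
    exact (Finset.mem_filter.1 h).2 i
  · intro k
    refine measurable_to_countable' fun i => ?_
    have hset : ∀ i : Fin (k + 1), MeasurableSet {x : Fin (k + 1) → ℝ | ∀ j, x j ≤ x i} := by
      intro i
      rw [Set.ofPred_forall]
      exact MeasurableSet.iInter fun j =>
        measurableSet_le (measurable_pi_apply j) (measurable_pi_apply i)
    have heq : (fun x : Fin (k + 1) → ℝ =>
          (Finset.univ.filter fun i => ∀ j, x j ≤ x i).min' (hne k x)) ⁻¹' {i} =
        {x : Fin (k + 1) → ℝ | ∀ j, x j ≤ x i} ∩ ⋂ l : Fin (k + 1), ⋂ _ : l < i, {x : Fin (k + 1) → ℝ | ∀ j, x j ≤ x l}ᶜ := by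
      ext x
      simp only [Set.mem_preimage, Set.mem_singleton_iff, Set.mem_inter_iff, Set.mem_iInter]
      constructor
      · intro h
        subst h
        refine ⟨(Finset.mem_filter.1 (Finset.min'_mem _ (hne k x))).2, fun l hl hx => ?_⟩
        exact absurd (Finset.min'_le _ l (Finset.mem_filter.2 ⟨Finset.mem_univ _, hx⟩))
          (not_le.2 hl)
      · rintro ⟨h1, h2⟩
        refine le_antisymm (Finset.min'_le _ i (Finset.mem_filter.2 ⟨Finset.mem_univ _, h1⟩)) ?_
        refine Finset.le_min' _ (hne k x) i fun l hl => ?_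
        by_contra hlt
        exact h2 l (not_le.1 hlt) (Finset.mem_filter.1 hl).2
    rw [heq]
    exact (hset i).inter (MeasurableSet.iInter fun l => MeasurableSet.iInter fun _ => (hset l).compl)

section LSVI

variable {d : ℕ} (I : PlanningInput d) (H n : ℕ) (ρ : ℕ → (I.State × I.Action →₀ ℝ))

/-- Clipping to `[-H, H]`. -/
def clip (H x : ℝ) : ℝ := max (min x H) (-H)

/-- The functions computed by least-squares value iteration, indexed by the number `j` of steps to go:
`lsviQ j` is `f_h` for the stage `h = H - j` (stages numbered from `0`). The `i`-th sample (reward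
and next state) at stage `h` and design point `z` is `data h z i`. -/
def lsviQ (data : ℕ → I.State × I.Action → ℕ → ℝ × I.State) : ℕ → I.State → I.Action → ℝ
  | 0 => fun _ _ => 0
  | j + 1 => fun s a =>
      clip H (I.feature (H - (j + 1)) (s, a) ⬝ᵥ
        lsEstimator (I.feature (H - (j + 1))) (ρ (H - (j + 1))) fun z =>
          (1 / (n : ℝ)) * ∑ i ∈ Finset.range n,
            ((data (H - (j + 1)) z i).1 + ⨆ a', lsviQ data j (data (H - (j + 1)) z i).2 a'))

/-- The samples to be collected: for every stage, `n` samples at each support point of the design. -/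
def sampleSet : Finset (Σ _ : ℕ, (I.State × I.Action) × ℕ) :=
  (Finset.range H).sigma fun h => (ρ h).support ×ˢ Finset.range n

/-- Query, in some fixed order, for all the samples of `sampleSet`, each exactly once, then stop. -/
def lsviSampler : Sampler I.State I.Action where
  query t := Kernel.const _ (Measure.dirac
    (if ht : t < (sampleSet I H n ρ).card then
      ((sampleSet I H n ρ).equivFin.symm ⟨t, ht⟩).1.2.1 else (I.init, 0)))
  cont t := Kernel.const _ (Measure.dirac (decide (t + 1 < (sampleSet I H n ρ).card)))
  markov_query _ := inferInstance
  markov_cont _ := inferInstance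

open Classical in
/-- The samples contained in a history (with a default value for samples not collected). -/
def lsviData (t : ℕ) (y : Fin t → Step I.State I.Action) (h : ℕ) (z : I.State × I.Action) (i : ℕ) :
    ℝ × I.State :=
  if hx : (⟨h, z, i⟩ : Σ _ : ℕ, (I.State × I.Action) × ℕ) ∈ sampleSet I H n ρ then
    if ht : ((sampleSet I H n ρ).equivFin ⟨_, hx⟩ : ℕ) < t then (y ⟨_, ht⟩).1.2 else (0, I.init)
  else (0, I.init)

theorem measurable_lsviData (t h : ℕ) (z : I.State × I.Action) (i : ℕ) :
    Measurable fun y : Fin t → Step I.State I.Action => lsviData I H n ρ t y h z i := by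
  unfold lsviData
  split_ifs
  · exact (measurable_pi_apply _).fst.snd
  · exact measurable_const
  · exact measurable_const

theorem measurable_lsviQ {Ω : Type*} [MeasurableSpace Ω]
    (data : Ω → ℕ → I.State × I.Action → ℕ → ℝ × I.State)
    (hdata : ∀ h z i, Measurable fun ω => data ω h z i) (j : ℕ) (a : I.Action) :
    Measurable fun p : Ω × I.State => lsviQ I H n ρ (data p.1) j p.2 a := by
  induction j generalizing a with
  | zero => exact measurable_const
  | succ j ih =>
    have hmax : Measurable fun p : Ω × I.State => ⨆ a', lsviQ I H n ρ (data p.1) j p.2 a' :=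
      Measurable.iSup ih
    have hr : ∀ z, Measurable fun p : Ω × I.State => (1 / (n : ℝ)) * ∑ i ∈ Finset.range n,
        ((data p.1 (H - (j + 1)) z i).1 +
          ⨆ a', lsviQ I H n ρ (data p.1) j (data p.1 (H - (j + 1)) z i).2 a') := by
      intro z
      refine measurable_const.mul (Finset.measurable_sum _ fun i _ => ?_)
      have hd : Measurable fun p : Ω × I.State => data p.1 (H - (j + 1)) z i :=
        (hdata _ z i).comp measurable_fst
      exact hd.fst.add (hmax.comp (measurable_fst.prodMk hd.snd))
    have hφ : ∀ l, Measurable fun p : Ω × I.State => I.feature (H - (j + 1)) (p.2, a) l := fun l =>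
      (measurable_pi_apply l).comp
        ((I.measurable_feature _).comp (measurable_snd.prodMk measurable_const))
    simp only [lsviQ, clip, lsEstimator, dotProduct, Matrix.mulVec, Finset.sum_apply, Pi.smul_apply,
      smul_eq_mul]
    refine Measurable.max (Measurable.min ?_ measurable_const) measurable_const
    refine Finset.measurable_sum _ fun l _ => (hφ l).mul ?_
    refine Finset.measurable_sum _ fun m _ => measurable_const.mul ?_
    exact Finset.measurable_sum _ fun z _ => (measurable_const.mul (hr z)).mul_const _

end LSVI

/-- Least-squares value iteration with the designs given by `D` and `n` samples per design point,
followed by greedy actions with respect to the computed functions. -/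
def lsvi {d : ℕ} (D : DesignRule d) (τ : ArgmaxRule) (H n : ℕ) : GlobalPlanner d where
  sampler I := lsviSampler I H n (D I)
  readout I t y h s :=
    τ.choose I.actionsPred (lsviQ I H n (D I) (lsviData I H n (D I) t y) (H - h) s)
  measurable_readout I t h := (τ.measurable_choose _).comp <| measurable_pi_lambda _ fun a =>
    measurable_lsviQ I H n (D I) (fun y => lsviData I H n (D I) t y)
      (fun h z i => measurable_lsviData I H n (D I) t h z i) (H - h) a

end QPlanning

end

/-! Designs. On a compact set of features, choose `2 d` vectors `v i` that maximize `det N`, where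
`N = P + ∑ v i (v i)ᵀ` and `P` projects onto the orthogonal complement of the span. Exchanging `v i`
for a feature `z` cannot increase the determinant. These `2 d` inequalities, summed over `i`, give
`zᵀ N⁻¹ z ≤ 1` (`exists_exact_design`). Uniform weights `1 / (2 d)` then give variance at most `2 d`
with at most `2 d` support points, so `K = 2` suffices.

Error propagation. Put `κ = √(2 d)`. By Cauchy-Schwarz, an error of at most `ε` at the design points
becomes at most `κ ε` at every pair of the stage (`abs_dotProduct_lsEstimator_sub_le`). If all
regression targets are within `ε` of their conditional means, realizability gives the recursion `e
(j + 1) ≤ κ (ε + e j)` for the error with `j` steps to go, so errors grow like `ε κ ^ j`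
(`abs_lsviQ_sub_optQ_le`). A greedy action loses at most twice the error, and by the
performance-difference bound the losses add up to at most `32 ε κ ^ H`.

Concentration. All queries are fixed in advance, so the rounds of a run are independent
(`run_eq_infinitePi`). The value function used in a target depends only on samples of later stages,
hence is independent of the samples averaged in that target. Hoeffding's inequality therefore
applies conditionally, without a covering argument over value functions
(`measure_lsviTarget_deviation_le`), and a union bound over the design points follows.

Soundness. For `δ ≤ H` take `ε = δ / (64 κ ^ H)` and failure probability `η = δ / (2 H²)`. A
successful global run has gap at most `δ / 2`, and a failure costs at most `H`. The local planner
can fail afresh at every stage, which costs at most `H * (H * η) = δ / 2` in total. For `δ > H`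
every policy is sound. -/

namespace QPlanning

/-! ### The Moore-Penrose inverse of a symmetric matrix -/

section Pinv

variable {d : ℕ} {G : Matrix (Fin d) (Fin d) ℝ}

/-- A finite set carries no continuity obstruction, so the functional calculus applies to `x⁻¹` even
when `0` is an eigenvalue. -/
theorem continuousOn_spectrum_real (f : ℝ → ℝ) : ContinuousOn f (spectrum ℝ G) :=
  Matrix.finite_real_spectrum.continuousOn f

theorem mul_symmPinv_mul_self (hG : IsSelfAdjoint G) : G * symmPinv G * G = G := by
  have hid : cfc (fun x : ℝ => x) G = G := cfc_id' ℝ G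
  have h1 := cfc_mul (fun x : ℝ => x) (fun x : ℝ => x⁻¹) G (continuousOn_spectrum_real _)
    (continuousOn_spectrum_real _)
  have h2 := cfc_mul (fun x : ℝ => x * x⁻¹) (fun x : ℝ => x) G (continuousOn_spectrum_real _)
    (continuousOn_spectrum_real _)
  rw [h1, hid] at h2
  unfold symmPinv
  rw [← h2]
  conv_rhs => rw [← hid]
  congr 1
  funext x
  -- This includes `x = 0`, because `0⁻¹ = 0`.
  exact mul_inv_mul_cancel x

theorem mul_symmPinv_comm : G * symmPinv G = symmPinv G * G := by
  by_cases hG : IsSelfAdjoint G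
  · have hid : cfc (fun x : ℝ => x) G = G := cfc_id' ℝ G
    have h := cfc_commute_cfc (fun x : ℝ => x) (fun x : ℝ => x⁻¹) G
    rw [hid] at h
    exact h
  -- For a matrix that is not self-adjoint `cfc` takes the default value `0`.
  · simp [symmPinv, cfc_apply_of_not_predicate G hG]

theorem transpose_symmPinv (G : Matrix (Fin d) (Fin d) ℝ) : (symmPinv G)ᵀ = symmPinv G := by
  have h : IsSelfAdjoint (symmPinv G) := cfc_predicate _ G
  simpa [IsSelfAdjoint, Matrix.star_eq_conjTranspose] using h

end Pinv

theorem dotProduct_mulVec_comm_of_transpose {d : ℕ} {A : Matrix (Fin d) (Fin d) ℝ} (hA : Aᵀ = A)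
    (x y : Fin d → ℝ) : x ⬝ᵥ (A *ᵥ y) = (A *ᵥ x) ⬝ᵥ y := by
  rw [Matrix.dotProduct_mulVec, ← Matrix.mulVec_transpose, hA]

theorem dotProduct_self_eq_zero_of_real {d : ℕ} {x : Fin d → ℝ} (h : x ⬝ᵥ x = 0) : x = 0 :=
  dotProduct_self_eq_zero.1 h

/-! ### Weighted Gram matrices -/

/-- The matrix `∑ i ∈ s, w i • v i (v i)ᵀ`. -/
noncomputable def weightedGram {d : ℕ} {ι : Type*} (s : Finset ι) (w : ι → ℝ) (v : ι → Fin d → ℝ) :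
    Matrix (Fin d) (Fin d) ℝ :=
  ∑ i ∈ s, w i • Matrix.vecMulVec (v i) (v i)

section WeightedGram

variable {d : ℕ} {ι : Type*} (s : Finset ι) (w : ι → ℝ) (v : ι → Fin d → ℝ)

theorem transpose_weightedGram : (weightedGram s w v)ᵀ = weightedGram s w v := by
  simp [weightedGram, Matrix.transpose_sum, Matrix.transpose_vecMulVec]

theorem isSelfAdjoint_weightedGram : IsSelfAdjoint (weightedGram s w v) := by
  rw [IsSelfAdjoint, Matrix.star_eq_conjTranspose, Matrix.conjTranspose_eq_transpose_of_trivial,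
    transpose_weightedGram]

theorem weightedGram_mulVec (x : Fin d → ℝ) :
    weightedGram s w v *ᵥ x = ∑ i ∈ s, (w i * (v i ⬝ᵥ x)) • v i := by
  rw [weightedGram, Matrix.sum_mulVec]
  refine Finset.sum_congr rfl fun i _ => ?_
  rw [Matrix.smul_mulVec, Matrix.vecMulVec_mulVec, mul_smul]
  simp

theorem dotProduct_weightedGram_mulVec (x y : Fin d → ℝ) :
    y ⬝ᵥ (weightedGram s w v *ᵥ x) = ∑ i ∈ s, w i * (v i ⬝ᵥ x) * (v i ⬝ᵥ y) := by
  rw [weightedGram_mulVec, dotProduct_sum]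
  refine Finset.sum_congr rfl fun i _ => ?_
  rw [dotProduct_smul, smul_eq_mul, dotProduct_comm y]

variable {s w v}

/-- The quadratic form at `x` is a sum of squares with positive weights, so each term vanishes with
it. -/
theorem dotProduct_eq_zero_of_weightedGram_mulVec_eq_zero (hw : ∀ i ∈ s, 0 < w i) {x : Fin d → ℝ}
    (hx : weightedGram s w v *ᵥ x = 0) {i : ι} (hi : i ∈ s) : v i ⬝ᵥ x = 0 := by
  have h := dotProduct_weightedGram_mulVec s w v x x
  rw [hx, dotProduct_zero] at h
  have h' := (Finset.sum_eq_zero_iff_of_nonneg fun i hi => by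
    rw [mul_assoc]; exact mul_nonneg (hw i hi).le (mul_self_nonneg _)).1 h.symm i hi
  rw [mul_assoc] at h'
  rcases mul_eq_zero.1 h' with h0 | h0
  · exact absurd h0 (hw i hi).ne'
  · exact mul_self_eq_zero.1 h0

/-- The residual of a generator `v i` lies in the kernel, hence is orthogonal to `v i`; by symmetry
it is also orthogonal to the range. So it is orthogonal to itself. Linearity extends this to the
span. -/
theorem weightedGram_mulVec_symmPinv_mulVec (hw : ∀ i ∈ s, 0 < w i) {x : Fin d → ℝ}
    (hx : x ∈ Submodule.span ℝ (v '' s)) :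
    weightedGram s w v *ᵥ (symmPinv (weightedGram s w v) *ᵥ x) = x := by
  set G := weightedGram s w v with hGdef
  have hG : IsSelfAdjoint G := isSelfAdjoint_weightedGram s w v
  have hker : ∀ y : Fin d → ℝ, G *ᵥ (y - G *ᵥ (symmPinv G *ᵥ y)) = 0 := fun y => by
    rw [Matrix.mulVec_sub, sub_eq_zero, Matrix.mulVec_mulVec _ G (symmPinv G), mul_symmPinv_comm,
      Matrix.mulVec_mulVec, ← Matrix.mul_assoc, mul_symmPinv_mul_self hG]
  induction hx using Submodule.span_induction with
  | mem y hy =>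
    obtain ⟨i, hi, rfl⟩ := hy
    have h1 := hker (v i)
    have h2 := dotProduct_eq_zero_of_weightedGram_mulVec_eq_zero hw h1 hi
    refine (sub_eq_zero.1 (dotProduct_self_eq_zero_of_real ?_)).symm
    rw [sub_dotProduct, h2, ← dotProduct_mulVec_comm_of_transpose (transpose_weightedGram s w v), h1]
    simp
  | zero => simp
  | add y z _ _ hy hz => rw [Matrix.mulVec_add, Matrix.mulVec_add, hy, hz]
  | smul a y _ hy => rw [Matrix.mulVec_smul, Matrix.mulVec_smul, hy]

theorem weightedGram_mulVec_mem_span (x : Fin d → ℝ) :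
    weightedGram s w v *ᵥ x ∈ Submodule.span ℝ (v '' s) := by
  rw [weightedGram_mulVec]
  exact Submodule.sum_mem _ fun i hi =>
    Submodule.smul_mem _ _ (Submodule.subset_span ⟨i, hi, rfl⟩)

/-- The orthogonal projection onto the complement of the span of finitely many vectors. -/
theorem exists_projection_ker_eq_span (s : Finset ι) (v : ι → Fin d → ℝ) :
    ∃ P : Matrix (Fin d) (Fin d) ℝ, Pᵀ = P ∧ P * P = P ∧
      ∀ x, P *ᵥ x = 0 ↔ x ∈ Submodule.span ℝ (v '' s) := by
  set S := weightedGram s 1 v with hS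
  have hSa : IsSelfAdjoint S := isSelfAdjoint_weightedGram s 1 v
  have hSt : Sᵀ = S := transpose_weightedGram s 1 v
  -- `S * symmPinv S` is the orthogonal projection onto the range of `S`, which is the span.
  refine ⟨1 - S * symmPinv S, ?_, ?_, fun x => ?_⟩
  · rw [Matrix.transpose_sub, Matrix.transpose_mul, transpose_symmPinv, hSt, Matrix.transpose_one,
      mul_symmPinv_comm]
  · have : S * symmPinv S * (S * symmPinv S) = S * symmPinv S := by
      rw [← Matrix.mul_assoc, mul_symmPinv_mul_self hSa]
    rw [sub_mul, mul_sub, mul_sub, this]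
    simp
  · rw [Matrix.sub_mulVec, Matrix.one_mulVec, sub_eq_zero, ← Matrix.mulVec_mulVec]
    constructor
    · intro h
      rw [h]
      exact weightedGram_mulVec_mem_span _
    · intro h
      exact (weightedGram_mulVec_symmPinv_mulVec (fun _ _ => one_pos) h).symm

end WeightedGram

/-! ### Exact designs that maximize the determinant -/

/-- An exchange of points is a perturbation of rank two, so the matrix determinant lemma reduces it
to a determinant of size two. -/
theorem det_sub_vecMulVec_add_vecMulVec {d : ℕ} {N : Matrix (Fin d) (Fin d) ℝ} (hN : IsUnit N.det)
    (hNt : Nᵀ = N) (v z : Fin d → ℝ) :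
    (N - Matrix.vecMulVec v v + Matrix.vecMulVec z z).det =
      N.det * ((1 - v ⬝ᵥ (N⁻¹ *ᵥ v)) * (1 + z ⬝ᵥ (N⁻¹ *ᵥ z)) + (v ⬝ᵥ (N⁻¹ *ᵥ z)) ^ 2) := by
  have hit : (N⁻¹)ᵀ = N⁻¹ := by rw [Matrix.transpose_nonsing_inv, hNt]
  let U : Matrix (Fin d) (Fin 2) ℝ := Matrix.of fun i => ![-v i, z i]
  let V : Matrix (Fin 2) (Fin d) ℝ := Matrix.of ![v, z]
  have hUV : N - Matrix.vecMulVec v v + Matrix.vecMulVec z z = N + U * V := by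
    ext i j
    simp [U, V, Matrix.mul_apply, Fin.sum_univ_two, Matrix.vecMulVec_apply]
    ring
  have hmul : ∀ a b, (V * N⁻¹ * U) a b = V a ⬝ᵥ (N⁻¹ *ᵥ fun i => U i b) := fun a b => by
    rw [Matrix.mul_assoc, Matrix.mul_apply]
    rfl
  have hU0 : (fun i => U i 0) = -v := by ext i; simp [U]
  have hU1 : (fun i => U i 1) = z := by ext i; simp [U]
  have hV0 : V 0 = v := rfl
  have hV1 : V 1 = z := rfl
  have hsym : z ⬝ᵥ (N⁻¹ *ᵥ v) = v ⬝ᵥ (N⁻¹ *ᵥ z) := by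
    rw [dotProduct_mulVec_comm_of_transpose hit, dotProduct_comm]
  rw [hUV, Matrix.det_add_mul U V hN, Matrix.det_fin_two]
  simp only [Matrix.add_apply, hmul, hU0, hU1, hV0, hV1, Matrix.mulVec_neg, dotProduct_neg, hsym]
  congr 1
  simp
  ring

theorem trace_mul_weightedGram {d : ℕ} {ι : Type*} (s : Finset ι) (v : ι → Fin d → ℝ)
    (A : Matrix (Fin d) (Fin d) ℝ) :
    (A * weightedGram s 1 v).trace = ∑ i ∈ s, v i ⬝ᵥ (A *ᵥ v i) := by
  rw [weightedGram, Finset.mul_sum, Matrix.trace_sum]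
  refine Finset.sum_congr rfl fun i _ => ?_
  rw [Pi.one_apply, one_smul, Matrix.mul_vecMulVec, Matrix.trace_vecMulVec, dotProduct_comm]

/-- A tuple of `2 d` points of `Φ` that maximizes the determinant has variances at most `1` on `Φ`:
every `z ∈ Φ` is `N y` with `N = ∑ i, v i (v i)ᵀ` and `yᵀ z ≤ 1`. -/
theorem exists_exact_design {d : ℕ} (hd : 1 ≤ d) {Φ : Set (Fin d → ℝ)} (hΦ : IsCompact Φ)
    (hne : Φ.Nonempty) :
    ∃ v : Fin (2 * d) → Fin d → ℝ, (∀ i, v i ∈ Φ) ∧ ∀ z ∈ Φ, ∃ y,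
      weightedGram Finset.univ 1 v *ᵥ y = z ∧ y ⬝ᵥ z ≤ 1 := by
  obtain ⟨x₀, hx₀⟩ := hne
  obtain ⟨b, hbΦ, hspan, hli⟩ := exists_linearIndependent ℝ Φ
  have : Finite b := hli.finite
  have : Fintype b := Fintype.ofFinite b
  obtain ⟨P, hPt, hPP, hPker⟩ := exists_projection_ker_eq_span (Finset.univ : Finset b)
    (fun x : b => (x : Fin d → ℝ))
  have himage : (fun x : b => (x : Fin d → ℝ)) '' ((Finset.univ : Finset b) : Set b) = b := by simp
  rw [himage] at hPker
  have hPΦ : ∀ z ∈ Φ, P *ᵥ z = 0 := fun z hz =>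
    (hPker z).2 (hspan ▸ Submodule.subset_span hz)
  -- Adding `P` allows an invertible matrix even if `Φ` does not span the space; `P` vanishes on
  -- `Φ`.
  let N : (Fin (2 * d) → Fin d → ℝ) → Matrix (Fin d) (Fin d) ℝ := fun v =>
    P + weightedGram Finset.univ 1 v
  have hNt : ∀ v, (N v)ᵀ = N v := fun v => by
    simp only [N, Matrix.transpose_add, hPt, transpose_weightedGram]
  have hcont : Continuous fun v => (N v).det := by
    refine Continuous.matrix_det (continuous_const.add ?_)
    unfold weightedGram
    refine continuous_finsetSum _ fun i _ => ?_
    simp only [Pi.one_apply, one_smul]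
    exact (continuous_apply i).matrix_vecMulVec (continuous_apply i)
  -- a tuple with positive determinant
  have hcard : Fintype.card b ≤ 2 * d := by
    have := hli.fintype_card_le_finrank
    rw [Module.finrank_fin_fun, ← Nat.card_eq_fintype_card] at this
    rw [← Nat.card_eq_fintype_card]
    exact this.trans (by omega)
  obtain ⟨e⟩ : Nonempty (b ↪ Fin (2 * d)) :=
    Function.Embedding.nonempty_of_card_le (by simpa using hcard)
  -- A basis of the span, taken inside `Φ`, occupies some of the slots; the remaining ones are
  -- filled with `x₀`.
  let v₀ : Fin (2 * d) → Fin d → ℝ := Function.extend e Subtype.val fun _ => x₀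
  have hv₀Φ : ∀ i, v₀ i ∈ Φ := fun i => by
    by_cases h : ∃ x, e x = i
    · obtain ⟨x, rfl⟩ := h
      simp only [v₀, e.injective.extend_apply]
      exact hbΦ x.2
    · simpa only [v₀, Function.extend_apply' _ _ _ h] using hx₀
  have hquad : ∀ v x, x ⬝ᵥ (N v *ᵥ x) = (P *ᵥ x) ⬝ᵥ (P *ᵥ x) + ∑ i, (v i ⬝ᵥ x) ^ 2 := by
    intro v x
    simp only [N, Matrix.add_mulVec, dotProduct_add]
    rw [dotProduct_weightedGram_mulVec, ← dotProduct_mulVec_comm_of_transpose hPt,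
      Matrix.mulVec_mulVec, hPP]
    simp [sq]
  have hpos : 0 < (N v₀).det := by
    refine Matrix.PosDef.det_pos (Matrix.PosDef.of_dotProduct_mulVec_pos ?_ fun x hx => ?_)
    · rw [Matrix.IsHermitian, Matrix.conjTranspose_eq_transpose_of_trivial, hNt]
    · rw [star_trivial, hquad]
      have h1 : 0 ≤ (P *ᵥ x) ⬝ᵥ (P *ᵥ x) := Finset.sum_nonneg fun i _ => mul_self_nonneg _
      have h2 : 0 ≤ ∑ i, (v₀ i ⬝ᵥ x) ^ 2 := Finset.sum_nonneg fun i _ => sq_nonneg _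
      refine lt_of_le_of_ne (add_nonneg h1 h2) fun h0 => hx ?_
      have hP0 : P *ᵥ x = 0 := dotProduct_self_eq_zero_of_real (by linarith)
      have hs0 : ∑ i, (v₀ i ⬝ᵥ x) ^ 2 = 0 := by linarith
      have hv0 : ∀ i, v₀ i ⬝ᵥ x = 0 := fun i => by
        have := (Finset.sum_eq_zero_iff_of_nonneg fun i _ => sq_nonneg (v₀ i ⬝ᵥ x)).1 hs0 i
          (Finset.mem_univ i)
        exact pow_eq_zero_iff (two_ne_zero) |>.1 this
      have hb0 : ∀ y ∈ Submodule.span ℝ b, y ⬝ᵥ x = 0 := by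
        intro y hy
        induction hy using Submodule.span_induction with
        | mem y hy =>
          have := hv0 (e ⟨y, hy⟩)
          rwa [show v₀ (e ⟨y, hy⟩) = y from e.injective.extend_apply _ _ _] at this
        | zero => simp
        | add y z _ _ hy hz => rw [add_dotProduct, hy, hz, add_zero]
        | smul a y _ hy => rw [smul_dotProduct, hy, smul_zero]
      exact dotProduct_self_eq_zero_of_real (hb0 x ((hPker x).1 hP0))
  obtain ⟨v, hv, hmax⟩ := (isCompact_univ_pi fun _ : Fin (2 * d) => hΦ).exists_isMaxOn
    ⟨v₀, fun i _ => hv₀Φ i⟩ hcont.continuousOn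
  have hvΦ : ∀ i, v i ∈ Φ := fun i => hv i (Set.mem_univ i)
  have hdet : 0 < (N v).det := hpos.trans_le (hmax (a := v₀) fun i _ => hv₀Φ i)
  have hunit : IsUnit (N v).det := hdet.ne'.isUnit
  refine ⟨v, hvΦ, fun z hz => ⟨(N v)⁻¹ *ᵥ z, ?_⟩⟩
  set G := weightedGram Finset.univ 1 v with hG
  set M := (N v)⁻¹ with hM
  have hMt : Mᵀ = M := by rw [hM, Matrix.transpose_nonsing_inv, hNt]
  have hNM : N v * M = 1 := Matrix.mul_nonsing_inv _ hunit
  have hMN : M * N v = 1 := Matrix.nonsing_inv_mul _ hunit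
  -- `G` and `P` live on orthogonal subspaces, so `N v` and its inverse act as the identity on the
  -- range of `P`.
  have hGP : G * P = 0 := by
    ext i j
    have : (G * P) i j = (G *ᵥ fun k => P k j) i := rfl
    rw [this, hG, weightedGram_mulVec]
    have : ∀ i, v i ⬝ᵥ (fun k => P k j) = (P *ᵥ v i) j := fun i => by
      rw [dotProduct_comm]
      conv_rhs => rw [← hPt]
      rfl
    simp [this, hPΦ _ (hvΦ _)]
  have hNP : N v * P = P := by
    simp only [N, add_mul]
    rw [hPP, ← hG, hGP, add_zero]
  have hMP : M * P = P := by
    calc M * P = M * (N v * P) := by rw [hNP]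
      _ = P := by rw [← Matrix.mul_assoc, hMN, Matrix.one_mul]
  have hPM : P * M = P := by
    have := congrArg Matrix.transpose hMP
    rwa [Matrix.transpose_mul, hPt, hMt] at this
  have hGN : G = N v - P := by simp only [N]; rw [hG]; simp
  have hGz : G *ᵥ (M *ᵥ z) = z := by
    rw [Matrix.mulVec_mulVec, hGN, sub_mul, hNM, hPM, Matrix.sub_mulVec, hPΦ z hz]
    simp
  refine ⟨hGz, ?_⟩
  rw [dotProduct_comm]
  set β := z ⬝ᵥ (M *ᵥ z) with hβ
  -- Replacing the `i`-th point by `z` multiplies the maximal determinant by the left-hand side.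
  have hexch : ∀ i, (1 - v i ⬝ᵥ (M *ᵥ v i)) * (1 + β) + (v i ⬝ᵥ (M *ᵥ z)) ^ 2 ≤ 1 := by
    intro i
    have hupd : N (Function.update v i z) = N v - Matrix.vecMulVec (v i) (v i)
        + Matrix.vecMulVec z z := by
      simp only [N, weightedGram, Pi.one_apply, one_smul]
      rw [← Finset.add_sum_erase _ _ (Finset.mem_univ i), ← Finset.add_sum_erase Finset.univ
        (fun i => Matrix.vecMulVec (v i) (v i)) (Finset.mem_univ i)]
      rw [Finset.sum_congr rfl fun j hj => by
        rw [Function.update_of_ne (Finset.ne_of_mem_erase hj)]]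
      rw [Function.update_self]
      abel
    have hle : (N (Function.update v i z)).det ≤ (N v).det := by
      refine hmax (a := Function.update v i z) fun j _ => ?_
      rcases eq_or_ne j i with rfl | hj
      · rwa [Function.update_self]
      · rw [Function.update_of_ne hj]; exact hvΦ j
    rw [hupd, det_sub_vecMulVec_add_vecMulVec hunit (hNt v)] at hle
    nlinarith
  -- The sum reads `(2 d - ∑ v iᵀ M v i) (1 + β) + β ≤ 2 d`. As the inner sum is `d - tr P ≤ d`,
  -- this gives `(d + 1) β ≤ d`. Using `2 d` points instead of `d` is what leaves the factor `d` in
  -- front of `1 + β`.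
  have hsum := Finset.sum_le_sum fun i (_ : i ∈ (Finset.univ : Finset (Fin (2 * d)))) => hexch i
  rw [Finset.sum_add_distrib, ← Finset.sum_mul, Finset.sum_sub_distrib] at hsum
  have hsq : ∑ i, (v i ⬝ᵥ (M *ᵥ z)) ^ 2 = β := by
    have := dotProduct_weightedGram_mulVec Finset.univ 1 v (M *ᵥ z) (M *ᵥ z)
    rw [← hG, hGz, dotProduct_comm] at this
    rw [hβ, this]
    simp [sq]
  have htr : ∑ i, v i ⬝ᵥ (M *ᵥ v i) ≤ d := by
    rw [← trace_mul_weightedGram, ← hG, hGN, mul_sub, hMN, hMP, Matrix.trace_sub]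
    have hPtr : 0 ≤ P.trace := by
      rw [← hPP]
      refine Finset.sum_nonneg fun i _ => ?_
      rw [Matrix.diag_apply, Matrix.mul_apply]
      refine Finset.sum_nonneg fun j _ => ?_
      rw [show P j i = P i j from by conv_lhs => rw [← hPt, Matrix.transpose_apply]]
      exact mul_self_nonneg _
    simp [hPtr]
  rw [hsq] at hsum
  simp only [Finset.sum_const, Finset.card_univ, Fintype.card_fin, nsmul_eq_mul, mul_one,
    Nat.cast_mul, Nat.cast_ofNat] at hsum
  have hd' : (1 : ℝ) ≤ d := by exact_mod_cast hd
  have hβ0 : 0 ≤ β := by rw [← hsq]; positivity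
  nlinarith

/-! ### Existence of near-optimal designs -/

/-- For `d ≥ 16`, `log d ≥ 4 log 2 > e` makes the double logarithm at least `1`; for `3 ≤ d < 16` it
is nonnegative and `16` suffices. At `d = 1` it is `0` by the convention `log 0 = 0`, and at `d = 2`
it is at least `-1`. -/
theorem natCast_le_mul_log_log {d : ℕ} (hd : 1 ≤ d) :
    (d : ℝ) ≤ 4 * d * Real.log (Real.log d) + 16 := by
  have he := Real.exp_one_lt_d9
  rcases le_or_gt 16 d with h16 | h16
  · have h16' : (16 : ℝ) ≤ d := by exact_mod_cast h16
    have hlog : Real.exp 1 ≤ Real.log d := by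
      have h1 : Real.log 16 ≤ Real.log d := Real.log_le_log (by norm_num) h16'
      have h2 : Real.log 16 = 4 * Real.log 2 := by
        rw [show (16 : ℝ) = 2 ^ 4 by norm_num, Real.log_pow]; norm_num
      have h3 := Real.log_two_gt_d9
      linarith
    have h1 : 1 ≤ Real.log (Real.log d) :=
      (Real.le_log_iff_exp_le ((Real.exp_pos 1).trans_le hlog)).2 hlog
    nlinarith
  · have h16' : (d : ℝ) ≤ 16 := by exact_mod_cast h16.le
    rcases le_or_gt 3 d with h3 | h3
    · have h3' : (3 : ℝ) ≤ d := by exact_mod_cast h3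
      have hlog : 1 ≤ Real.log d := by
        rw [Real.le_log_iff_exp_le (by linarith)]
        linarith
      have h1 : 0 ≤ Real.log (Real.log d) := Real.log_nonneg hlog
      have : 0 ≤ 4 * (d : ℝ) * Real.log (Real.log d) := by positivity
      linarith
    · obtain rfl | rfl : d = 1 ∨ d = 2 := by omega
      · norm_num
      · have h2 := Real.log_two_gt_d9
        have h := Real.one_sub_inv_le_log_of_pos (show 0 < Real.log 2 by linarith)
        have : (Real.log 2)⁻¹ ≤ 2 := by
          rw [inv_le_comm₀ (by linarith) (by norm_num)]; linarith
        push_cast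
        linarith

section Design

variable {d : ℕ} {Z : Type} {φ : Z → Fin d → ℝ} {ρ : Z →₀ ℝ}

theorem designMatrix_eq_weightedGram (φ : Z → Fin d → ℝ) (ρ : Z →₀ ℝ) :
    designMatrix φ ρ = weightedGram ρ.support ρ φ := rfl

theorem exists_isNearOptimalDesign (hd : 1 ≤ d) {Z₀ : Set Z} (hne : Z₀.Nonempty)
    (hcpt : IsCompact (φ '' Z₀)) : ∃ ρ, IsNearOptimalDesign 2 φ Z₀ ρ := by
  classical
  obtain ⟨v, hv, hy⟩ := exists_exact_design hd hcpt (hne.image φ)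
  choose z hz hzv using hv
  have hd0 : (0 : ℝ) < 2 * d := by have : (0 : ℝ) < d := by exact_mod_cast hd
                                   linarith
  set ρ : Z →₀ ℝ := ∑ i, Finsupp.single (z i) (1 / (2 * d : ℝ)) with hρ
  -- The points `z i` may coincide and their weights then add up; sums that are additive in the
  -- weight can still be taken over the index `i`.
  have hsum : ∀ {N : Type} [AddCommMonoid N] (h : Z → ℝ → N), (∀ a, h a 0 = 0) →
      (∀ a b₁ b₂, h a (b₁ + b₂) = h a b₁ + h a b₂) →
      ∑ a ∈ ρ.support, h a (ρ a) = ∑ i, h (z i) (1 / (2 * d : ℝ)) := by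
    intro N _ h h0 hadd
    have := Finsupp.sum_finsetSum_index (s := Finset.univ)
      (g := fun i => Finsupp.single (z i) (1 / (2 * d : ℝ))) h0 hadd
    rw [← hρ] at this
    rw [show ∑ a ∈ ρ.support, h a (ρ a) = ρ.sum h from rfl, ← this]
    exact Finset.sum_congr rfl fun i _ => Finsupp.sum_single_index (h0 _)
  have hsupp : ρ.support ⊆ Finset.univ.image z := by
    intro a ha
    obtain ⟨i, _, hi⟩ := Finset.mem_biUnion.1 (Finsupp.support_finsetSum ha)
    rw [Finset.mem_singleton.1 (Finsupp.support_single_subset hi)]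
    exact Finset.mem_image_of_mem z (Finset.mem_univ i)
  have hG : designMatrix φ ρ = (1 / (2 * d : ℝ)) • weightedGram Finset.univ 1 v := by
    rw [designMatrix, hsum (fun a w => w • Matrix.vecMulVec (φ a) (φ a)) (fun a => zero_smul _ _)
      (fun a b₁ b₂ => add_smul _ _ _), weightedGram, Finset.smul_sum]
    simp only [hzv, Pi.one_apply, one_smul]
  have hsolve : ∀ x ∈ Z₀, ∃ y, designMatrix φ ρ *ᵥ y = φ x ∧ y ⬝ᵥ φ x ≤ 2 * d := by
    intro x hx
    obtain ⟨y, hy1, hy2⟩ := hy (φ x) ⟨x, hx, rfl⟩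
    refine ⟨(2 * d : ℝ) • y, ?_, ?_⟩
    · rw [hG, Matrix.mulVec_smul, Matrix.smul_mulVec, hy1, smul_smul,
        mul_one_div_cancel hd0.ne', one_smul]
    · rw [smul_dotProduct, smul_eq_mul]
      nlinarith
  refine ⟨ρ, ?_, ?_, ?_, ?_, ?_, ?_⟩
  · intro a ha
    obtain ⟨i, _, rfl⟩ := Finset.mem_image.1 (hsupp ha)
    exact hz i
  · intro a
    rw [hρ, Finsupp.finsetSum_apply]
    refine Finset.sum_nonneg fun i _ => ?_
    rw [Finsupp.single_apply]
    split_ifs <;> positivity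
  · rw [hsum (fun _ w => w) (fun _ => rfl) (fun _ _ _ => rfl)]
    simp [field]
  · have h1 : ρ.support.card ≤ 2 * d := by
      refine (Finset.card_le_card hsupp).trans (Finset.card_image_le.trans ?_)
      simp
    have h2 : (ρ.support.card : ℝ) ≤ 2 * d := by exact_mod_cast h1
    have := natCast_le_mul_log_log hd
    linarith
  · intro x hx
    obtain ⟨y, hy1, -⟩ := hsolve x hx
    rw [← hy1, designMatrix_eq_weightedGram]
    exact weightedGram_mulVec_mem_span y
  · intro x hx
    obtain ⟨y, hy1, hy2⟩ := hsolve x hx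
    have hsa : IsSelfAdjoint (designMatrix φ ρ) := isSelfAdjoint_weightedGram _ _ _
    have ht : (designMatrix φ ρ)ᵀ = designMatrix φ ρ := transpose_weightedGram _ _ _
    refine le_of_eq_of_le ?_ hy2
    -- With `φ x = G y` the variance is `yᵀ G G† G y = yᵀ G y`.
    conv_lhs => rw [← hy1]
    rw [← dotProduct_mulVec_comm_of_transpose ht, Matrix.mulVec_mulVec, Matrix.mulVec_mulVec,
      mul_symmPinv_mul_self hsa, hy1]

/-! ### The error of the least-squares estimator -/

/-- With `w = G† φ z`, the error is the `ρ`-average of `(r x - φ x ⬝ᵥ θ) * (φ x ⬝ᵥ w)`.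
Cauchy-Schwarz applies: the second factor has mean square equal to the variance at `z`, the first at
most `ε ^ 2`. -/
theorem abs_dotProduct_lsEstimator_sub_le {K : ℝ} {Z₀ : Set Z} (hρ : IsNearOptimalDesign K φ Z₀ ρ)
    {z : Z} (hz : z ∈ Z₀) {r : Z → ℝ} {θ : Fin d → ℝ} {ε : ℝ}
    (hr : ∀ x ∈ ρ.support, |r x - φ x ⬝ᵥ θ| ≤ ε) :
    |φ z ⬝ᵥ lsEstimator φ ρ r - φ z ⬝ᵥ θ| ≤ √(2 * d) * ε := by
  set G := designMatrix φ ρ with hGdef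
  have hGt : Gᵀ = G := transpose_weightedGram _ _ _
  have hpos : ∀ x ∈ ρ.support, 0 < ρ x := fun x hx =>
    lt_of_le_of_ne (hρ.nonneg x) (Finsupp.mem_support_iff.1 hx).symm
  set w := symmPinv G *ᵥ φ z with hw
  have hGw : G *ᵥ w = φ z := weightedGram_mulVec_symmPinv_mulVec hpos (hρ.mem_span z hz)
  have hls : φ z ⬝ᵥ lsEstimator φ ρ r = ∑ x ∈ ρ.support, ρ x * r x * (φ x ⬝ᵥ w) := by
    rw [lsEstimator, dotProduct_mulVec_comm_of_transpose (transpose_symmPinv _), dotProduct_sum]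
    refine Finset.sum_congr rfl fun x _ => ?_
    rw [dotProduct_smul, smul_eq_mul, dotProduct_comm]
  have hth : φ z ⬝ᵥ θ = ∑ x ∈ ρ.support, ρ x * (φ x ⬝ᵥ θ) * (φ x ⬝ᵥ w) := by
    rw [← hGw, ← dotProduct_mulVec_comm_of_transpose hGt, hGdef, designMatrix_eq_weightedGram,
      dotProduct_weightedGram_mulVec]
  have hww : ∑ x ∈ ρ.support, ρ x * (φ x ⬝ᵥ w) ^ 2 ≤ 2 * d := by
    refine le_of_eq_of_le ?_ (hρ.variance_le z hz)
    rw [← hGdef, ← hw, ← hGw, ← dotProduct_mulVec_comm_of_transpose hGt, hGdef,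
      designMatrix_eq_weightedGram, dotProduct_weightedGram_mulVec]
    refine Finset.sum_congr rfl fun x _ => by ring
  -- A support point is needed to infer `0 ≤ ε` from `hr`.
  have hne : ρ.support.Nonempty := by
    by_contra h
    have := hρ.sum_eq_one
    rw [Finset.not_nonempty_iff_eq_empty.1 h, Finset.sum_empty] at this
    exact zero_ne_one this
  have hε : 0 ≤ ε := (abs_nonneg _).trans (hr _ hne.choose_spec)
  have hee : ∑ x ∈ ρ.support, ρ x * (r x - φ x ⬝ᵥ θ) ^ 2 ≤ ε ^ 2 := by
    calc ∑ x ∈ ρ.support, ρ x * (r x - φ x ⬝ᵥ θ) ^ 2 ≤ ∑ x ∈ ρ.support, ρ x * ε ^ 2 :=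
          Finset.sum_le_sum fun x hx => mul_le_mul_of_nonneg_left
            (sq_le_sq' (abs_le.1 (hr x hx)).1 (abs_le.1 (hr x hx)).2) (hρ.nonneg x)
      _ = ε ^ 2 := by rw [← Finset.sum_mul, hρ.sum_eq_one, one_mul]
  refine abs_le_of_sq_le_sq ?_ (by positivity)
  rw [mul_pow, Real.sq_sqrt (by positivity), hls, hth, ← Finset.sum_sub_distrib]
  calc (∑ x ∈ ρ.support, (ρ x * r x * (φ x ⬝ᵥ w) - ρ x * (φ x ⬝ᵥ θ) * (φ x ⬝ᵥ w))) ^ 2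
      ≤ (∑ x ∈ ρ.support, ρ x * (φ x ⬝ᵥ w) ^ 2) *
          ∑ x ∈ ρ.support, ρ x * (r x - φ x ⬝ᵥ θ) ^ 2 := by
        refine Finset.sum_sq_le_sum_mul_sum_of_sq_le_mul _
          (fun x _ => mul_nonneg (hρ.nonneg x) (sq_nonneg _))
          (fun x _ => mul_nonneg (hρ.nonneg x) (sq_nonneg _)) fun x _ => le_of_eq (by ring)
    _ ≤ 2 * d * ε ^ 2 := mul_le_mul hww hee
        (Finset.sum_nonneg fun x _ => mul_nonneg (hρ.nonneg x) (sq_nonneg _)) (by positivity)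

end Design

/-! ### Finite suprema -/

section FiniteSup

variable {A : Type*} [Finite A]

theorem le_iSup_of_finite (f : A → ℝ) (a : A) : f a ≤ ⨆ a, f a :=
  le_ciSup (Set.finite_range f).bddAbove a

theorem iSup_mem_Icc [Nonempty A] {f : A → ℝ} {b c : ℝ} (h : ∀ a, f a ∈ Set.Icc b c) :
    ⨆ a, f a ∈ Set.Icc b c :=
  ⟨(h (Classical.arbitrary A)).1.trans (le_iSup_of_finite f _), ciSup_le fun a => (h a).2⟩

theorem abs_iSup_sub_iSup_le [Nonempty A] {f g : A → ℝ} {ε : ℝ} (h : ∀ a, |f a - g a| ≤ ε) :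
    |(⨆ a, f a) - ⨆ a, g a| ≤ ε := by
  rw [abs_sub_le_iff]
  constructor
  · rw [sub_le_iff_le_add]
    exact ciSup_le fun a => by linarith [(abs_sub_le_iff.1 (h a)).1, le_iSup_of_finite g a]
  · rw [sub_le_iff_le_add]
    exact ciSup_le fun a => by linarith [(abs_sub_le_iff.1 (h a)).2, le_iSup_of_finite f a]

end FiniteSup

/-! ### Integrals of functions with values in an interval -/

theorem integrable_of_mem_Icc {Ω : Type*} [MeasurableSpace Ω] {μ : Measure Ω} [IsFiniteMeasure μ]
    {f : Ω → ℝ} (hf : Measurable f) {b c : ℝ} (h : ∀ ω, f ω ∈ Set.Icc b c) : Integrable f μ :=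
  Integrable.of_mem_Icc b c hf.aemeasurable (ae_of_all _ h)

theorem integral_mem_Icc {Ω : Type*} [MeasurableSpace Ω] {μ : Measure Ω} [IsProbabilityMeasure μ]
    {f : Ω → ℝ} {b c : ℝ} (hf : AEMeasurable f μ) (h : ∀ᵐ ω ∂μ, f ω ∈ Set.Icc b c) :
    ∫ ω, f ω ∂μ ∈ Set.Icc b c := by
  have hi : Integrable f μ := Integrable.of_mem_Icc b c hf h
  constructor
  · simpa using integral_mono_ae (integrable_const b) hi (h.mono fun _ hx => hx.1)
  · simpa using integral_mono_ae hi (integrable_const c) (h.mono fun _ hx => hx.2)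

/-! ### Value functions -/

namespace MDP

section Measurable

variable {S A : Type} [MeasurableSpace S] [MeasurableSpace A] (M : MDP S A)

instance (s : S) (a : A) : IsProbabilityMeasure (M.next s a) :=
  Measure.isProbabilityMeasure_map measurable_snd.aemeasurable

theorem measurable_reward (a : A) : Measurable fun s => M.reward s a := by
  have h : StronglyMeasurable fun z : S × A => ∫ x, x.1 ∂(M.Q z) :=
    StronglyMeasurable.integral_kernel (κ := M.Q) measurable_fst.stronglyMeasurable
  exact h.measurable.comp (measurable_id.prodMk measurable_const)

theorem integral_snd_eq_integral_next {g : S → ℝ} (hg : Measurable g) (s : S) (a : A) :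
    ∫ x, g x.2 ∂(M.Q (s, a)) = ∫ s', g s' ∂(M.next s a) := by
  rw [MDP.next, integral_map measurable_snd.aemeasurable hg.aestronglyMeasurable]

theorem measurable_integral_next {g : S → ℝ} (hg : Measurable g) (a : A) :
    Measurable fun s => ∫ s', g s' ∂(M.next s a) := by
  have h : StronglyMeasurable fun z : S × A => ∫ x, g x.2 ∂(M.Q z) :=
    StronglyMeasurable.integral_kernel (κ := M.Q) (hg.comp measurable_snd).stronglyMeasurable
  simp only [← M.integral_snd_eq_integral_next hg]
  exact h.measurable.comp (measurable_id.prodMk (measurable_const (a := a)))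

variable {M}

theorem reward_mem_Icc (hM : ∀ z, ∀ᵐ x ∂(M.Q z), x.1 ∈ Set.Icc (0 : ℝ) 1) (s : S) (a : A) :
    M.reward s a ∈ Set.Icc (0 : ℝ) 1 :=
  integral_mem_Icc measurable_fst.aemeasurable (hM (s, a))

variable (M) in
theorem measurable_optQ [Finite A] (j : ℕ) (a : A) : Measurable fun s => M.optQ j s a := by
  induction j generalizing a with
  | zero => exact measurable_const
  | succ j ih =>
    exact (M.measurable_reward a).add (M.measurable_integral_next (Measurable.iSup ih) a)

theorem optQ_mem_Icc [Finite A] [Nonempty A] (hM : ∀ z, ∀ᵐ x ∂(M.Q z), x.1 ∈ Set.Icc (0 : ℝ) 1)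
    (j : ℕ) (s : S) (a : A) : M.optQ j s a ∈ Set.Icc (0 : ℝ) j := by
  induction j generalizing s a with
  | zero => simp [optQ]
  | succ j ih =>
    have h1 := reward_mem_Icc hM s a
    have h2 : ∫ s', (⨆ a', M.optQ j s' a') ∂(M.next s a) ∈ Set.Icc (0 : ℝ) j :=
      integral_mem_Icc (Measurable.iSup (M.measurable_optQ j)).aemeasurable
        (ae_of_all _ fun s' => iSup_mem_Icc fun a' => ih s' a')
    simp only [optQ, Set.mem_Icc] at *
    push_cast
    constructor <;> linarith

end Measurable

/-- `π` is a measurable memoryless policy. -/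
structure IsPolicy {S A : Type} [MeasurableSpace S] [Fintype A] (π : ℕ → S → A → ℝ) : Prop where
  measurable : ∀ h a, Measurable fun s => π h s a
  nonneg : ∀ h s a, 0 ≤ π h s a
  sum_eq_one : ∀ h s, ∑ a, π h s a = 1

theorem IsPolicy.sum_mul_mem_Icc {S A : Type} [MeasurableSpace S] [Fintype A]
    {π : ℕ → S → A → ℝ} (hπ : IsPolicy π) (h : ℕ) (s : S) {x : A → ℝ} {b c : ℝ}
    (hx : ∀ a, x a ∈ Set.Icc b c) : ∑ a, π h s a * x a ∈ Set.Icc b c := by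
  constructor
  · calc b = ∑ a, π h s a * b := by rw [← Finset.sum_mul, hπ.sum_eq_one, one_mul]
      _ ≤ _ := Finset.sum_le_sum fun a _ => mul_le_mul_of_nonneg_left (hx a).1 (hπ.nonneg h s a)
  · calc _ ≤ ∑ a, π h s a * c :=
          Finset.sum_le_sum fun a _ => mul_le_mul_of_nonneg_left (hx a).2 (hπ.nonneg h s a)
      _ = c := by rw [← Finset.sum_mul, hπ.sum_eq_one, one_mul]

/-- In a hereditarily Lindelöf space the support has full measure. This is what allows estimates
known only on accessible states to be integrated. -/
theorem ae_next_mem_reach {S A : Type} [MeasurableSpace S] [MeasurableSpace A] [TopologicalSpace S]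
    [HereditarilyLindelofSpace S] {M : MDP S A} {h : ℕ} {s : S} (hs : s ∈ M.reach h) (a : A) :
    ∀ᵐ s' ∂(M.next s a), s' ∈ M.reach (h + 1) := by
  filter_upwards [Measure.support_mem_ae (μ := M.next s a)] with s' hs'
  exact ⟨a, s, hs, hs'⟩

theorem reach_nonempty {S A : Type} [MeasurableSpace S] [MeasurableSpace A] [TopologicalSpace S]
    [HereditarilyLindelofSpace S] [Nonempty A] (M : MDP S A) (h : ℕ) : (M.reach h).Nonempty := by
  induction h with
  | zero => exact ⟨M.init, rfl⟩
  | succ h ih =>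
    obtain ⟨s, hs⟩ := ih
    exact (ae_next_mem_reach hs (Classical.arbitrary A)).exists

section PolValue

variable {S A : Type} [MeasurableSpace S] [MeasurableSpace A] [Fintype A]
  {M : MDP S A} {π : ℕ → S → A → ℝ}

theorem measurable_polValue (hπ : IsPolicy π) (j h : ℕ) : Measurable fun s => M.polValue π j h s := by
  induction j generalizing h with
  | zero => exact measurable_const
  | succ j ih =>
    exact Finset.measurable_sum _ fun a _ => (hπ.measurable h a).mul
      ((M.measurable_reward a).add (M.measurable_integral_next (ih (h + 1)) a))

theorem polValue_mem_Icc (hM : ∀ z, ∀ᵐ x ∂(M.Q z), x.1 ∈ Set.Icc (0 : ℝ) 1) (hπ : IsPolicy π)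
    (j h : ℕ) (s : S) : M.polValue π j h s ∈ Set.Icc (0 : ℝ) j := by
  induction j generalizing h s with
  | zero => simp [polValue]
  | succ j ih =>
    refine hπ.sum_mul_mem_Icc h s fun a => ?_
    have h1 := reward_mem_Icc hM s a
    have h2 := integral_mem_Icc (μ := M.next s a) (measurable_polValue (M := M) hπ j (h + 1)).aemeasurable
        (ae_of_all _ fun s' => ih (h + 1) s')
    simp only [Set.mem_Icc] at *
    push_cast
    constructor <;> linarith

variable [TopologicalSpace S]

theorem suboptimality_le_horizon [Nonempty A]
    (hM : ∀ z, ∀ᵐ x ∂(M.Q z), x.1 ∈ Set.Icc (0 : ℝ) 1) (hπ : IsPolicy π) (H : ℕ) :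
    M.suboptimality H π ≤ ENNReal.ofReal H := by
  refine iSup₂_le fun h hh => iSup₂_le fun s hs => ENNReal.ofReal_le_ofReal ?_
  have h1 : M.vStar H h s ∈ Set.Icc (0 : ℝ) (H - h : ℕ) :=
    iSup_mem_Icc fun a => optQ_mem_Icc hM (H - h) s a
  have h2 := (polValue_mem_Icc hM hπ (H - h) h s).1
  have h3 : ((H - h : ℕ) : ℝ) ≤ H := by exact_mod_cast Nat.sub_le H h
  have : M.vPol H π h s = M.polValue π (H - h) h s := rfl
  linarith [h1.2]

variable [HereditarilyLindelofSpace S]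

/-- The performance-difference bound: if in every accessible state `π` loses at most `β (H - h)` at
stage `h` compared with an optimal action, then the losses add up along an episode. -/
theorem iSup_optQ_sub_polValue_le [Nonempty A]
    (hM : ∀ z, ∀ᵐ x ∂(M.Q z), x.1 ∈ Set.Icc (0 : ℝ) 1) (hπ : IsPolicy π) {H : ℕ} {β : ℕ → ℝ}
    (hβ : ∀ j < H, ∀ s ∈ M.reach (H - (j + 1)),
      ∑ a, π (H - (j + 1)) s a * ((⨆ a', M.optQ (j + 1) s a') - M.optQ (j + 1) s a) ≤ β j)
    {j : ℕ} (hj : j ≤ H) {s : S} (hs : s ∈ M.reach (H - j)) :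
    (⨆ a, M.optQ j s a) - M.polValue π j (H - j) s ≤ ∑ i ∈ Finset.range j, β i := by
  induction j generalizing s with
  | zero => simp [optQ, polValue]
  | succ j ih =>
    have hstage : H - (j + 1) + 1 = H - j := by omega
    have hV : Measurable fun s => ⨆ a, M.optQ j s a := Measurable.iSup (M.measurable_optQ j)
    have hstep : ∀ a, M.optQ (j + 1) s a - (M.reward s a +
        ∫ s', M.polValue π j (H - (j + 1) + 1) s' ∂(M.next s a)) ≤ ∑ i ∈ Finset.range j, β i := by
      intro a
      have hiV : Integrable (fun s' => ⨆ a, M.optQ j s' a) (M.next s a) :=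
        integrable_of_mem_Icc hV fun s' => iSup_mem_Icc fun a => optQ_mem_Icc hM j s' a
      have hip : Integrable (fun s' => M.polValue π j (H - j) s') (M.next s a) :=
        integrable_of_mem_Icc (measurable_polValue hπ j _) fun s' => polValue_mem_Icc hM hπ j _ s'
      rw [hstage]
      simp only [optQ]
      rw [add_sub_add_left_eq_sub, ← integral_sub hiV hip]
      have hle := integral_mono_ae (hiV.sub hip)
        (integrable_const (μ := M.next s a) (∑ i ∈ Finset.range j, β i)) (by
          filter_upwards [ae_next_mem_reach hs a] with s' hs'
          rw [hstage] at hs'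
          exact ih (by omega) hs')
      simpa using hle
    rw [Finset.sum_range_succ]
    -- The total loss is the expected later loss after the action of `π` plus the immediate loss of
    -- that action.
    have hsplit : (⨆ a, M.optQ (j + 1) s a) - M.polValue π (j + 1) (H - (j + 1)) s =
        ∑ a, π (H - (j + 1)) s a * (M.optQ (j + 1) s a - (M.reward s a +
          ∫ s', M.polValue π j (H - (j + 1) + 1) s' ∂(M.next s a))) +
        ∑ a, π (H - (j + 1)) s a * ((⨆ a', M.optQ (j + 1) s a') - M.optQ (j + 1) s a) := by
      rw [← Finset.sum_add_distrib]
      simp only [← mul_add, polValue]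
      have hone : ⨆ a, M.optQ (j + 1) s a =
          ∑ a, π (H - (j + 1)) s a * ⨆ a', M.optQ (j + 1) s a' := by
        rw [← Finset.sum_mul, hπ.sum_eq_one, one_mul]
      rw [hone, ← Finset.sum_sub_distrib, ← hone]
      exact Finset.sum_congr rfl fun a _ => by ring
    rw [hsplit]
    refine add_le_add ?_ (hβ j (by omega) s hs)
    calc _ ≤ ∑ a, π (H - (j + 1)) s a * ∑ i ∈ Finset.range j, β i :=
          Finset.sum_le_sum fun a _ => mul_le_mul_of_nonneg_left (hstep a) (hπ.nonneg _ _ _)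
      _ = _ := by rw [← Finset.sum_mul, hπ.sum_eq_one, one_mul]

/-- All partial sums must be bounded, because the gap is a supremum over all starting stages. -/
theorem suboptimality_le_of_loss_le [Nonempty A]
    (hM : ∀ z, ∀ᵐ x ∂(M.Q z), x.1 ∈ Set.Icc (0 : ℝ) 1) (hπ : IsPolicy π) {H : ℕ} {β : ℕ → ℝ} {B : ℝ}
    (hβ : ∀ j < H, ∀ s ∈ M.reach (H - (j + 1)),
      ∑ a, π (H - (j + 1)) s a * ((⨆ a', M.optQ (j + 1) s a') - M.optQ (j + 1) s a) ≤ β j)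
    (hB : ∀ j ≤ H, ∑ i ∈ Finset.range j, β i ≤ B) :
    M.suboptimality H π ≤ ENNReal.ofReal B := by
  refine iSup₂_le fun h hh => iSup₂_le fun s hs => ENNReal.ofReal_le_ofReal ?_
  have hst : H - (H - h) = h := by omega
  have := iSup_optQ_sub_polValue_le hM hπ hβ (Nat.sub_le H h) (s := s) (by rwa [hst])
  rw [hst] at this
  exact this.trans (hB _ (Nat.sub_le H h))

end PolValue

end MDP

/-! ### Error propagation in least-squares value iteration -/

theorem clip_mem_Icc {H : ℝ} (hH : 0 ≤ H) (x : ℝ) : clip H x ∈ Set.Icc (-H) H :=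
  ⟨le_max_right _ _, max_le (min_le_right _ _) (by linarith)⟩

/-- Clipping is `1`-Lipschitz and fixes `q`. -/
theorem abs_clip_sub_le {H x q : ℝ} (hq : q ∈ Set.Icc (-H) H) : |clip H x - q| ≤ |x - q| := by
  have hqc : clip H q = q := by
    rw [clip, min_eq_left hq.2, max_eq_left hq.1]
  conv_lhs => rw [← hqc]
  exact (abs_max_sub_max_le_abs _ _ _).trans (abs_min_sub_min_le_max _ _ _ _ |>.trans (by simp))

section Lsvi

variable {d : ℕ} (I : PlanningInput d) (H n : ℕ) (ρ : ℕ → (I.State × I.Action →₀ ℝ))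
  (data : ℕ → I.State × I.Action → ℕ → ℝ × I.State)

/-- The value function `max_a f_h(s, a)` with `j` steps to go. -/
noncomputable def lsviValue (j : ℕ) (s : I.State) : ℝ := ⨆ a, lsviQ I H n ρ data j s a

/-- The regression target `μ̂_h(z)` with `j + 1` steps to go. -/
noncomputable def lsviTarget (j : ℕ) (z : I.State × I.Action) : ℝ :=
  (1 / (n : ℝ)) * ∑ i ∈ Finset.range n,
    ((data (H - (j + 1)) z i).1 + lsviValue I H n ρ data j (data (H - (j + 1)) z i).2)

/-- The expectation of the regression target given the data of later stages. -/
noncomputable def lsviMean (M : MDP I.State I.Action) (j : ℕ) (z : I.State × I.Action) : ℝ :=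
  M.reward z.1 z.2 + ∫ s', lsviValue I H n ρ data j s' ∂(M.next z.1 z.2)

variable {I H n ρ data}

theorem lsviQ_mem_Icc (j : ℕ) (s : I.State) (a : I.Action) :
    lsviQ I H n ρ data j s a ∈ Set.Icc (-(H : ℝ)) H := by
  cases j with
  | zero => simp [lsviQ]
  | succ j => exact clip_mem_Icc (Nat.cast_nonneg H) _

theorem lsviValue_mem_Icc (j : ℕ) (s : I.State) :
    lsviValue I H n ρ data j s ∈ Set.Icc (-(H : ℝ)) H :=
  iSup_mem_Icc fun a => lsviQ_mem_Icc j s a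

variable (I H n ρ) in
theorem measurable_lsviValue {Ω : Type*} [MeasurableSpace Ω]
    {data : Ω → ℕ → I.State × I.Action → ℕ → ℝ × I.State}
    (hdata : ∀ h z i, Measurable fun ω => data ω h z i) (j : ℕ) :
    Measurable fun p : Ω × I.State => lsviValue I H n ρ (data p.1) j p.2 :=
  Measurable.iSup fun a => measurable_lsviQ I H n ρ data hdata j a

variable (I H n ρ data) in
theorem measurable_lsviValue_right (j : ℕ) : Measurable (lsviValue I H n ρ data j) :=
  (measurable_lsviValue I H n ρ (Ω := Unit) (data := fun _ => data)
    (fun _ _ _ => measurable_const) j).comp (measurable_const (a := ()) |>.prodMk measurable_id)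

end Lsvi

section Propagation

variable {H d n : ℕ} {X : Problem H d} {ρ : ℕ → (X.input.State × X.input.Action →₀ ℝ)}
  {data : ℕ → X.input.State × X.input.Action → ℕ → ℝ × X.input.State} {K ε : ℝ}

/-- Any lower bound of at least `4 / 3` makes the geometric recursions below close with the factor
`4`. -/
theorem seven_fifths_le_sqrt_two_mul {d : ℕ} (hd : 1 ≤ d) : (1.4 : ℝ) ≤ √(2 * d) := by
  have hd' : (1 : ℝ) ≤ d := by exact_mod_cast hd
  refine Real.le_sqrt_of_sq_le ?_
  norm_num
  linarith

/-- The bound solves `e (j + 1) ≤ κ (ε + e j)`, `e 0 = 0`: the target inherits the error of the next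
stage plus the noise `ε`, regression multiplies by `κ`, and clipping does no harm because the
optimal values lie in `[0, H]`. -/
theorem abs_lsviQ_sub_optQ_le (hd : 1 ≤ d)
    (hρ : ∀ h < H, IsNearOptimalDesign K (X.input.feature h) (X.input.pairs h) (ρ h)) (hε : 0 ≤ ε)
    (hgood : ∀ j < H, ∀ z ∈ (ρ (H - (j + 1))).support,
      |lsviTarget X.input H n ρ data j z - lsviMean X.input H n ρ data X.mdp j z| ≤ ε)
    {j : ℕ} (hj : j ≤ H) {s : X.input.State} (hs : s ∈ X.mdp.reach (H - j)) (a : X.input.Action) :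
    |lsviQ X.input H n ρ data j s a - X.mdp.optQ j s a| ≤ 4 * ε * (√(2 * d) ^ j - 1) := by
  induction j generalizing s a with
  | zero => simp [lsviQ, MDP.optQ]
  | succ j ih =>
    obtain ⟨θ, hθ⟩ := X.realizable
    set h := H - (j + 1) with hh
    have hstage : h + 1 = H - j := by omega
    have hhj : H - h = j + 1 := by omega
    have hhH : h < H := by omega
    have hreach : ∀ {s a}, (s, a) ∈ X.input.pairs h ↔ s ∈ X.mdp.reach h := fun {s a} => by
      rw [← X.stage_eq h hhH.le]; rfl
    have hq : ∀ z ∈ X.input.pairs h, X.mdp.optQ (j + 1) z.1 z.2 = X.input.feature h z ⬝ᵥ θ :=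
      fun z hz => by rw [← hθ h hhH z hz, MDP.qStar, hhj]
    have hs1 := seven_fifths_le_sqrt_two_mul hd
    set κ := √(2 * d) with hκ
    -- By realizability the regression target is a perturbation of a linear function of the
    -- features.
    have htarget : ∀ z ∈ (ρ h).support,
        |lsviTarget X.input H n ρ data j z - X.input.feature h z ⬝ᵥ θ| ≤
          ε + 4 * ε * (κ ^ j - 1) := by
      intro z hz
      have hzp : z ∈ X.input.pairs h := (hρ h hhH).support_subset hz
      rw [← hq z hzp]
      refine (abs_sub_le _ (lsviMean X.input H n ρ data X.mdp j z) _).trans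
        (add_le_add (hgood j (by omega) z hz) ?_)
      simp only [lsviMean, MDP.optQ]
      have hi1 : Integrable (lsviValue X.input H n ρ data j) (X.mdp.next z.1 z.2) :=
        integrable_of_mem_Icc (measurable_lsviValue_right _ _ _ _ _ _) (lsviValue_mem_Icc j)
      have hi2 : Integrable (fun s' => ⨆ a, X.mdp.optQ j s' a) (X.mdp.next z.1 z.2) :=
        integrable_of_mem_Icc (Measurable.iSup (X.mdp.measurable_optQ j)) fun s' =>
          iSup_mem_Icc fun a => MDP.optQ_mem_Icc X.bounded j s' a
      rw [add_sub_add_left_eq_sub, ← integral_sub hi1 hi2, ← Real.norm_eq_abs]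
      refine (norm_integral_le_of_norm_le_const (C := 4 * ε * (κ ^ j - 1)) ?_).trans (by simp)
      filter_upwards [MDP.ae_next_mem_reach (hreach.1 hzp) z.2] with s' hs'
      rw [hstage] at hs'
      exact abs_iSup_sub_iSup_le fun a => ih (by omega) hs' a
    have hsp : (s, a) ∈ X.input.pairs h := hreach.2 hs
    have hqm := MDP.optQ_mem_Icc X.bounded (j + 1) s a
    have hjH : ((j + 1 : ℕ) : ℝ) ≤ H := by exact_mod_cast hj
    have hls := abs_dotProduct_lsEstimator_sub_le (hρ h hhH) hsp htarget
    rw [← hq _ hsp] at hls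
    refine (abs_clip_sub_le (H := H) ⟨by linarith [hqm.1, (Nat.cast_nonneg H : (0 : ℝ) ≤ H)],
      hqm.2.trans hjH⟩).trans (hls.trans ?_)
    rw [pow_succ]
    -- This amounts to `4 ≤ 3 κ`.
    nlinarith [mul_nonneg hε (sub_nonneg.2 hs1)]

/-- The loss of an action that is greedy for the computed functions. -/
theorem iSup_optQ_sub_optQ_le_of_greedy (hd : 1 ≤ d)
    (hρ : ∀ h < H, IsNearOptimalDesign K (X.input.feature h) (X.input.pairs h) (ρ h)) (hε : 0 ≤ ε)
    (hgood : ∀ j < H, ∀ z ∈ (ρ (H - (j + 1))).support,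
      |lsviTarget X.input H n ρ data j z - lsviMean X.input H n ρ data X.mdp j z| ≤ ε)
    {j : ℕ} (hj : j ≤ H) {s : X.input.State} (hs : s ∈ X.mdp.reach (H - j)) (τ : ArgmaxRule) :
    (⨆ a, X.mdp.optQ j s a) -
        X.mdp.optQ j s (τ.choose X.input.actionsPred (lsviQ X.input H n ρ data j s)) ≤
      8 * ε * √(2 * d) ^ j := by
  have h := fun a => abs_le.1 (abs_lsviQ_sub_optQ_le hd hρ hε hgood hj hs a)
  rw [sub_le_iff_le_add]
  refine ciSup_le fun a => ?_
  have h1 := (h a).1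
  have h2 := (h (τ.choose X.input.actionsPred (lsviQ X.input H n ρ data j s))).2
  have h3 := τ.isMax X.input.actionsPred (lsviQ X.input H n ρ data j s) a
  nlinarith

theorem sum_pow_sqrt_le (hd : 1 ≤ d) (hε : 0 ≤ ε) {j : ℕ} (hj : j ≤ H) :
    ∑ i ∈ Finset.range j, 8 * ε * √(2 * d) ^ (i + 1) ≤ 32 * ε * √(2 * d) ^ H := by
  have hs1 := seven_fifths_le_sqrt_two_mul hd
  set κ := √(2 * d) with hκ
  -- The induction step needs `32 + 8 κ ≤ 32 κ`, that is, `κ ≥ 4 / 3`.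
  have h : ∑ i ∈ Finset.range j, 8 * ε * κ ^ (i + 1) ≤ 32 * ε * κ ^ j := by
    clear hj
    induction j with
    | zero => simp [hε]
    | succ j ih =>
      rw [Finset.sum_range_succ]
      have hpow : 0 ≤ ε * κ ^ j := by positivity
      rw [pow_succ]
      nlinarith [mul_nonneg hpow (sub_nonneg.2 hs1)]
  refine h.trans ?_
  gcongr
  linarith

end Propagation

/-! ### The law of a run that makes predetermined queries -/

namespace Sampler

variable {S A : Type} [MeasurableSpace S] [MeasurableSpace A]

/-- The law of a round in which `q` is queried and the decision is `b`. -/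
noncomputable def roundLaw (M : MDP S A) (q : S × A) (b : Bool) : Measure (Step S A) :=
  (M.Q q).map fun x => ((q, x), b)

theorem measurable_round (q : S × A) (b : Bool) :
    Measurable fun x : ℝ × S => (((q, x), b) : Step S A) :=
  (measurable_const.prodMk measurable_id).prodMk measurable_const

instance (M : MDP S A) (q : S × A) (b : Bool) : IsProbabilityMeasure (roundLaw M q b) :=
  Measure.isProbabilityMeasure_map (measurable_round q b).aemeasurable

/-- With a deterministic query and decision, only the simulator's answer is random, and the history
plays no role. -/
theorem stepKernel_eq_const {σ : Sampler S A} (M : MDP S A) {t : ℕ} {q : S × A} {b : Bool}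
    (hq : σ.query t = Kernel.const _ (Measure.dirac q))
    (hb : σ.cont t = Kernel.const _ (Measure.dirac b)) :
    σ.stepKernel M t = Kernel.const _ (roundLaw M q b) := by
  ext1 y
  refine Measure.ext_of_lintegral _ fun f hf => ?_
  have hf1 : ∀ z : (S × A) × (ℝ × S), ∫⁻ c, f (z, c) ∂(Measure.dirac b) = f (z, b) := fun z =>
    lintegral_dirac' b (hf.comp (measurable_const.prodMk measurable_id))
  rw [stepKernel, Kernel.lintegral_compProd _ _ _ hf, hb]
  simp only [Kernel.const_apply, hf1]
  have hf2 : Measurable fun z : (S × A) × (ℝ × S) => f (z, b) :=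
    hf.comp (measurable_id.prodMk measurable_const)
  rw [Kernel.lintegral_compProd _ _ _ hf2, hq, Kernel.const_apply]
  simp only [Kernel.prodMkLeft_apply]
  rw [lintegral_dirac' q (f := fun z => ∫⁻ x, f ((z, x), b) ∂(M.Q z))
    (Measurable.lintegral_kernel_prod_right (κ := M.Q) hf2), roundLaw,
    lintegral_map hf (measurable_round q b)]

/-- `Finset.Iic 0` has a single element; this identifies the initial law of the run with that of the
product construction. -/
theorem pi_Iic_zero_eq_map {X : ℕ → Type*} [∀ n, MeasurableSpace (X n)]
    (μ : (n : ℕ) → Measure (X n)) [∀ n, IsProbabilityMeasure (μ n)]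
    (f : X 0 → (i : Finset.Iic 0) → X i) (hf : Measurable f)
    (hf0 : ∀ x, f x ⟨0, Finset.mem_Iic.2 le_rfl⟩ = x) :
    Measure.pi (fun i : Finset.Iic 0 => μ i) = (μ 0).map f := by
  have huniq : ∀ i : Finset.Iic 0, i = ⟨0, Finset.mem_Iic.2 le_rfl⟩ := fun i =>
    Subtype.ext (Nat.le_zero.1 (Finset.mem_Iic.1 i.2))
  have : Subsingleton (Finset.Iic 0) := ⟨fun i j => (huniq i).trans (huniq j).symm⟩
  refine Measure.pi_eq (μ := fun i : Finset.Iic 0 => μ i) fun s hs => ?_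
  rw [Measure.map_apply hf (MeasurableSet.univ_pi hs), Fintype.prod_subsingleton _ ⟨0, Finset.mem_Iic.2 le_rfl⟩]
  congr 1
  ext x
  simp only [Set.mem_preimage, Set.mem_univ_pi]
  constructor
  · intro h
    have := h ⟨0, Finset.mem_Iic.2 le_rfl⟩
    rwa [hf0] at this
  · intro h i
    obtain rfl := huniq i
    rwa [hf0]

theorem traj_congr {X : ℕ → Type*} [∀ n, MeasurableSpace (X n)]
    {κ η : (n : ℕ) → Kernel ((i : Finset.Iic n) → X i) (X (n + 1))} [∀ n, IsMarkovKernel (κ n)]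
    [∀ n, IsMarkovKernel (η n)] (h : κ = η) :
    (Kernel.traj κ 0 : _ → Measure ((n : ℕ) → X n)) = Kernel.traj η 0 := by
  subst h
  rfl

/-- The Ionescu-Tulcea construction with constant kernels is the product measure. Independence of
the rounds comes from here. -/
theorem run_eq_infinitePi {σ : Sampler S A} (M : MDP S A) {q : ℕ → S × A} {b : ℕ → Bool}
    (hq : ∀ t, σ.query t = Kernel.const _ (Measure.dirac (q t)))
    (hb : ∀ t, σ.cont t = Kernel.const _ (Measure.dirac (b t))) :
    σ.run M = Measure.infinitePi fun t => roundLaw M (q t) (b t) := by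
  have h1 : σ.run M = Measure.infinitePiNat fun t => roundLaw M (q t) (b t) := by
    refine congrArg₂ Measure.bind ?_ (traj_congr (funext fun m => ?_))
    · rw [pi_Iic_zero_eq_map (fun t => roundLaw M (q t) (b t)) (fun x _ => x)
        (measurable_pi_lambda _ fun _ => measurable_id) fun _ => rfl,
        stepKernel_eq_const M (hq 0) (hb 0), Kernel.const_apply]
    · rw [stepKernel_eq_const M (hq (m + 1)) (hb (m + 1))]
      rfl
  rw [h1]
  exact (Measure.isProjectiveLimit_infinitePiNat _).unique (Measure.isProjectiveLimit_infinitePi _)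

end Sampler

/-! ### Hoeffding's inequality for an empirical mean -/

/-- Hoeffding's lemma gives each centred summand the variance proxy `(L / 2) ^ 2`; the two signs of
the deviation account for the factor `2`. -/
theorem pi_abs_mean_sub_integral_gt_le {Ω : Type*} [MeasurableSpace Ω] {μ : Measure Ω}
    [IsProbabilityMeasure μ] {g : Ω → ℝ} (hg : Measurable g) {b L : ℝ} (hL : 0 < L)
    (hgb : ∀ᵐ x ∂μ, g x ∈ Set.Icc b (b + L)) {n : ℕ} (hn : 0 < n) {ε : ℝ} (hε : 0 ≤ ε) :
    Measure.pi (fun _ : Fin n => μ) {x | ε < |(1 / (n : ℝ)) * ∑ i, g (x i) - ∫ y, g y ∂μ|} ≤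
      ENNReal.ofReal (2 * Real.exp (-(2 * n * ε ^ 2 / L ^ 2))) := by
  set P := Measure.pi (fun _ : Fin n => μ) with hP
  set m := ∫ y, g y ∂μ with hm
  have hn' : (0 : ℝ) < n := by exact_mod_cast hn
  have hsub : ∀ s : ℝ, (s = 1 ∨ s = -1) → P.real {x | n * ε ≤ ∑ i, s * (g (x i) - m)} ≤
      Real.exp (-(2 * n * ε ^ 2 / L ^ 2)) := by
    intro s hs
    have hsg : HasSubgaussianMGF (fun y => s * (g y - m)) ((‖b + L - b‖₊ / 2) ^ 2) μ := by
      have h0 := hasSubgaussianMGF_of_mem_Icc hg.aemeasurable hgb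
      rcases hs with rfl | rfl
      · simpa using h0
      · convert h0.neg using 1
        ext y
        simp [hm]
    have hmeas : Measurable fun y => s * (g y - m) := (hg.sub_const m).const_mul s
    have hind : iIndepFun (fun (i : Fin n) (x : Fin n → Ω) => s * (g (x i) - m)) P :=
      iIndepFun_pi (X := fun _ y => s * (g y - m)) fun _ => hmeas.aemeasurable
    have hcoord : ∀ i ∈ (Finset.univ : Finset (Fin n)),
        HasSubgaussianMGF (fun x : Fin n → Ω => s * (g (x i) - m)) ((‖b + L - b‖₊ / 2) ^ 2) P := by
      intro i _
      have hmp : P.map (Function.eval i) = μ := (measurePreserving_eval (fun _ : Fin n => μ) i).map_eq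
      rw [← hmp] at hsg
      have hY : AEMeasurable (Function.eval i : (Fin n → Ω) → Ω) P :=
        (measurable_pi_apply i).aemeasurable
      have h := hsg.of_map hY
      exact h
    refine (HasSubgaussianMGF.measure_sum_ge_le_of_iIndepFun hind hcoord (by positivity)).trans
      (le_of_eq ?_)
    congr 1
    have : (‖b + L - b‖₊ : ℝ) = L := by simp [abs_of_pos hL]
    simp only [Finset.sum_const, Finset.card_univ, Fintype.card_fin, nsmul_eq_mul]
    push_cast
    rw [coe_nnnorm] at this
    rw [this]
    field_simp
  have hincl : {x : Fin n → Ω | ε < |(1 / (n : ℝ)) * ∑ i, g (x i) - m|} ⊆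
      {x | n * ε ≤ ∑ i, (1 : ℝ) * (g (x i) - m)} ∪ {x | n * ε ≤ ∑ i, (-1 : ℝ) * (g (x i) - m)} := by
    intro x hx
    have hsum : ∑ i, (g (x i) - m) = n * ((1 / (n : ℝ)) * ∑ i, g (x i) - m) := by
      rw [Finset.sum_sub_distrib]
      simp
      field_simp
    simp only [Set.mem_union, Set.mem_ofPred_eq, ← Finset.mul_sum, hsum] at hx ⊢
    rcases lt_abs.1 hx with h | h
    · left; nlinarith
    · right; nlinarith
  refine (measure_mono hincl).trans ((measure_union_le _ _).trans ?_)
  rw [two_mul, ENNReal.ofReal_add (Real.exp_pos _).le (Real.exp_pos _).le]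
  refine add_le_add ?_ ?_
  · rw [← ofReal_measureReal]
    exact ENNReal.ofReal_le_ofReal (hsub 1 (Or.inl rfl))
  · rw [← ofReal_measureReal]
    exact ENNReal.ofReal_le_ofReal (hsub (-1) (Or.inr rfl))

/-! ### The data collected by least-squares value iteration -/

section Data

variable {d : ℕ} (I : PlanningInput d) (H n : ℕ) (ρ : ℕ → (I.State × I.Action →₀ ℝ))

theorem lsEstimator_congr {d : ℕ} {Z : Type} (φ : Z → Fin d → ℝ) {ρ : Z →₀ ℝ} {r r' : Z → ℝ}
    (h : ∀ z ∈ ρ.support, r z = r' z) : lsEstimator φ ρ r = lsEstimator φ ρ r' := by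
  unfold lsEstimator
  rw [Finset.sum_congr rfl fun z hz => by rw [h z hz]]

variable {I H n ρ} in
-- Only samples of stages from `H - j` on enter the recursion. This yields the independence of a
-- value function from the samples of earlier stages.
theorem lsviQ_congr {data data' : ℕ → I.State × I.Action → ℕ → ℝ × I.State} {j : ℕ} (hj : j ≤ H)
    (h : ∀ k, H - j ≤ k → k < H → ∀ z ∈ (ρ k).support, ∀ i < n, data k z i = data' k z i) :
    lsviQ I H n ρ data j = lsviQ I H n ρ data' j := by
  induction j with
  | zero => rfl
  | succ j ih =>
    have ih' := ih (by omega) fun k hk => h k (by omega)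
    funext s a
    simp only [lsviQ]
    rw [lsEstimator_congr _ fun z hz => ?_]
    rw [ih', Finset.sum_congr rfl fun i hi => by
      rw [h (H - (j + 1)) le_rfl (by omega) z hz i (Finset.mem_range.1 hi)]]

/-- The last round of a run (rounds being numbered from `0`). -/
noncomputable def lastRound : ℕ := (sampleSet I H n ρ).card - 1

/-- The data available when a run stops. -/
noncomputable def runData (ω : ℕ → Step I.State I.Action) :
    ℕ → I.State × I.Action → ℕ → ℝ × I.State :=
  lsviData I H n ρ (lastRound I H n ρ + 1) (firstRounds (lastRound I H n ρ + 1) ω)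

/-- The round in which a sample is collected. -/
noncomputable def sampleRound (x : sampleSet I H n ρ) : ℕ := (sampleSet I H n ρ).equivFin x

/-- The query of round `t`. -/
noncomputable def queryAt (t : ℕ) : I.State × I.Action :=
  if ht : t < (sampleSet I H n ρ).card then
    ((sampleSet I H n ρ).equivFin.symm ⟨t, ht⟩).1.2.1 else (I.init, 0)

variable {I H n ρ} in
theorem mem_sampleSet {h : ℕ} {z : I.State × I.Action} {i : ℕ} :
    (⟨h, z, i⟩ : Σ _ : ℕ, (I.State × I.Action) × ℕ) ∈ sampleSet I H n ρ ↔
      h < H ∧ z ∈ (ρ h).support ∧ i < n := by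
  simp [sampleSet]

variable {I H n ρ} in
theorem sampleRound_injective : Function.Injective (sampleRound I H n ρ) := fun _ _ h =>
  (sampleSet I H n ρ).equivFin.injective (Fin.ext h)

variable {I H n ρ} in
theorem queryAt_sampleRound (x : sampleSet I H n ρ) :
    queryAt I H n ρ (sampleRound I H n ρ x) = x.1.2.1 := by
  have hlt : sampleRound I H n ρ x < (sampleSet I H n ρ).card := Fin.is_lt _
  rw [queryAt, dif_pos hlt]
  congr 3
  exact (Equiv.symm_apply_eq _).2 (Fin.ext rfl)

variable {I H n ρ} in
theorem runData_eq (ω : ℕ → Step I.State I.Action) {h : ℕ} {z : I.State × I.Action} {i : ℕ}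
    (hx : (⟨h, z, i⟩ : Σ _ : ℕ, (I.State × I.Action) × ℕ) ∈ sampleSet I H n ρ) :
    runData I H n ρ ω h z i = (ω (sampleRound I H n ρ ⟨_, hx⟩)).1.2 := by
  have hlt : sampleRound I H n ρ ⟨_, hx⟩ < (sampleSet I H n ρ).card := Fin.is_lt _
  have hlt' : sampleRound I H n ρ ⟨_, hx⟩ < lastRound I H n ρ + 1 := by
    unfold lastRound
    omega
  rw [runData, lsviData, dif_pos hx]
  exact dif_pos hlt'

theorem measurable_firstRounds {S A : Type} [MeasurableSpace S] [MeasurableSpace A] (t : ℕ) :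
    Measurable (firstRounds (S := S) (A := A) t) :=
  measurable_pi_lambda _ fun _ => measurable_pi_apply _

theorem measurable_runData (h : ℕ) (z : I.State × I.Action) (i : ℕ) :
    Measurable fun ω => runData I H n ρ ω h z i :=
  (measurable_lsviData I H n ρ _ h z i).comp (measurable_firstRounds _)

variable (M : MDP I.State I.Action)

/-- The law of a run of least-squares value iteration. -/
noncomputable def lsviRun : Measure (ℕ → Step I.State I.Action) := (lsviSampler I H n ρ).run M

theorem lsviRun_eq_infinitePi : lsviRun I H n ρ M = Measure.infinitePi fun t =>
    Sampler.roundLaw M (queryAt I H n ρ t) (decide (t + 1 < (sampleSet I H n ρ).card)) :=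
  Sampler.run_eq_infinitePi M (fun _ => rfl) fun _ => rfl

instance : IsProbabilityMeasure (lsviRun I H n ρ M) := by
  rw [lsviRun_eq_infinitePi]
  infer_instance

theorem iIndepFun_rounds :
    iIndepFun (fun (t : ℕ) (ω : ℕ → Step I.State I.Action) => ω t) (lsviRun I H n ρ M) := by
  rw [lsviRun_eq_infinitePi]
  exact iIndepFun_infinitePi (X := fun _ ω => ω) fun _ => measurable_id

theorem map_round (t : ℕ) : (lsviRun I H n ρ M).map (fun ω => ω t) =
    Sampler.roundLaw M (queryAt I H n ρ t) (decide (t + 1 < (sampleSet I H n ρ).card)) := by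
  rw [lsviRun_eq_infinitePi]
  exact Measure.infinitePi_map_eval _ t

theorem map_answer (t : ℕ) :
    (lsviRun I H n ρ M).map (fun ω => (ω t).1.2) = M.Q (queryAt I H n ρ t) := by
  have h : Measurable fun x : Step I.State I.Action => x.1.2 := measurable_fst.snd
  have h2 := congrArg (Measure.map fun x : Step I.State I.Action => x.1.2) (map_round I H n ρ M t)
  rw [Measure.map_map h (measurable_pi_apply t), Sampler.roundLaw,
    Measure.map_map h (Sampler.measurable_round _ _)] at h2
  refine h2.trans ?_
  exact Measure.map_id

/-- The decisions are deterministic, so the stopping round is a constant. -/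
theorem ae_stopsAt_lastRound : ∀ᵐ ω ∂(lsviRun I H n ρ M), StopsAt ω (lastRound I H n ρ) := by
  have h : ∀ t, ∀ᵐ ω ∂(lsviRun I H n ρ M), (ω t).2 = decide (t + 1 < (sampleSet I H n ρ).card) := by
    intro t
    have hm : MeasurableSet {x : Step I.State I.Action |
        x.2 = decide (t + 1 < (sampleSet I H n ρ).card)} :=
      measurable_snd (measurableSet_singleton _)
    have h1 : ∀ᵐ x ∂((lsviRun I H n ρ M).map (fun ω => ω t)),
        x.2 = decide (t + 1 < (sampleSet I H n ρ).card) := by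
      rw [map_round, Sampler.roundLaw, ae_map_iff (Sampler.measurable_round _ _).aemeasurable hm]
      exact ae_of_all _ fun _ => rfl
    exact (ae_map_iff (measurable_pi_apply t).aemeasurable hm).1 h1
  filter_upwards [ae_all_iff.2 h] with ω hω
  refine ⟨?_, fun i hi => ?_⟩
  · rw [hω, decide_eq_false_iff_not, lastRound]
    omega
  · rw [hω, decide_eq_true_iff]
    unfold lastRound at hi
    omega

theorem measurableSet_stopsAt {S A : Type} [MeasurableSpace S] [MeasurableSpace A] (t : ℕ) :
    MeasurableSet {ω : ℕ → Step S A | StopsAt ω t} := by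
  have h : ∀ (i : ℕ) (c : Bool), MeasurableSet {ω : ℕ → Step S A | (ω i).2 = c} := fun i c =>
    (measurable_pi_apply i).snd (measurableSet_singleton c)
  have hset : {ω : ℕ → Step S A | StopsAt ω t} = {ω : ℕ → Step S A | (ω t).2 = false} ∩
      ⋂ i, ⋂ (_ : i < t), {ω : ℕ → Step S A | (ω i).2 = true} := by
    ext
    simp [StopsAt]
  rw [hset]
  exact (h t false).inter (MeasurableSet.iInter fun i => MeasurableSet.iInter fun _ => h i true)

theorem StopsAt.unique {S A : Type} {ω : ℕ → Step S A} {t t' : ℕ} (h : StopsAt ω t)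
    (h' : StopsAt ω t') : t = t' := by
  rcases lt_trichotomy t t' with hlt | heq | hlt
  · exact absurd (h'.2 t hlt) (by simp [h.1])
  · exact heq
  · exact absurd (h.2 t' hlt) (by simp [h'.1])

/-! ### Concentration of the regression targets -/

section Measurable

variable {Ω : Type*} [MeasurableSpace Ω] {data : Ω → ℕ → I.State × I.Action → ℕ → ℝ × I.State}

theorem measurable_lsviTarget (hdata : ∀ h z i, Measurable fun ω => data ω h z i) (j : ℕ)
    (z : I.State × I.Action) :
    Measurable fun ω => lsviTarget I H n ρ (data ω) j z := by
  refine measurable_const.mul (Finset.measurable_sum _ fun i _ => ?_)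
  have hd : Measurable fun ω => data ω (H - (j + 1)) z i := hdata _ z i
  exact hd.fst.add ((measurable_lsviValue I H n ρ hdata j).comp (measurable_id.prodMk hd.snd))

theorem measurable_lsviMean (hdata : ∀ h z i, Measurable fun ω => data ω h z i) (j : ℕ)
    (z : I.State × I.Action) :
    Measurable fun ω => lsviMean I H n ρ (data ω) M j z := by
  refine measurable_const.add ?_
  exact (measurable_lsviValue I H n ρ hdata j).stronglyMeasurable.integral_prod_right'.measurable

end Measurable

variable {M} in
theorem integral_reward_add_lsviValue (hM : ∀ z, ∀ᵐ x ∂(M.Q z), x.1 ∈ Set.Icc (0 : ℝ) 1)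
    (data : ℕ → I.State × I.Action → ℕ → ℝ × I.State) (j : ℕ) (z : I.State × I.Action) :
    ∫ x, (x.1 + lsviValue I H n ρ data j x.2) ∂(M.Q z) = lsviMean I H n ρ data M j z := by
  have hV := measurable_lsviValue_right I H n ρ data j
  have hi : Integrable (fun x : ℝ × I.State => lsviValue I H n ρ data j x.2) (M.Q z) :=
    integrable_of_mem_Icc (hV.comp measurable_snd) fun x => lsviValue_mem_Icc j x.2
  rw [integral_add (Integrable.of_mem_Icc 0 1 measurable_fst.aemeasurable (hM z)) hi, lsviMean, ← M.integral_snd_eq_integral_next hV]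
  rfl

variable {I H n ρ M} in
-- Conditionally on the rounds of later stages, the value function is fixed and the `n` samples at
-- `z` are still independent with law `M.Q z`. Hoeffding's inequality holds for each such value
-- function, and Fubini's theorem integrates it.
theorem measure_lsviTarget_deviation_le (hn : 0 < n)
    (hM : ∀ z, ∀ᵐ x ∂(M.Q z), x.1 ∈ Set.Icc (0 : ℝ) 1) {ε : ℝ} (hε : 0 ≤ ε) {j : ℕ} (hj : j < H)
    {z : I.State × I.Action} (hz : z ∈ (ρ (H - (j + 1))).support) :
    lsviRun I H n ρ M {ω | ε < |lsviTarget I H n ρ (runData I H n ρ ω) j z -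
        lsviMean I H n ρ (runData I H n ρ ω) M j z|} ≤
      ENNReal.ofReal (2 * Real.exp (-(2 * n * ε ^ 2 / (2 * H + 1) ^ 2))) := by
  classical
  set h := H - (j + 1) with hh
  have hhH : h < H := by omega
  set P := lsviRun I H n ρ M with hP
  have hmem : ∀ i : Fin n,
      (⟨h, z, i⟩ : Σ _ : ℕ, (I.State × I.Action) × ℕ) ∈ sampleSet I H n ρ := fun i =>
    mem_sampleSet.2 ⟨hhH, hz, i.2⟩
  let k : Fin n → ℕ := fun i => sampleRound I H n ρ ⟨_, hmem i⟩
  have hk : Function.Injective k := fun i i' hii => by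
    have h0 := congrArg Subtype.val (sampleRound_injective hii)
    simp only [Sigma.mk.injEq, heq_eq_eq, Prod.mk.injEq, true_and] at h0
    exact Fin.ext h0
  -- `S` collects the rounds of the samples at `z` in stage `h`, `T` those of all later stages.
  let S : Finset ℕ := Finset.univ.image k
  let T : Finset ℕ := (Finset.univ.filter fun x : sampleSet I H n ρ => h < x.1.1).image
    (sampleRound I H n ρ)
  have hdisj : Disjoint T S := by
    rw [Finset.disjoint_left]
    intro t htT htS
    obtain ⟨x, hx, rfl⟩ := Finset.mem_image.1 htT
    obtain ⟨i, _, hi⟩ := Finset.mem_image.1 htS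
    have := sampleRound_injective hi
    rw [← this] at hx
    exact lt_irrefl _ (Finset.mem_filter.1 hx).2
  -- the later data as a function of the rounds in `T`
  let late : (T → Step I.State I.Action) → ℕ → I.State × I.Action → ℕ → ℝ × I.State :=
    fun y h' z' i =>
      if hx : (⟨h', z', i⟩ : Σ _ : ℕ, (I.State × I.Action) × ℕ) ∈ sampleSet I H n ρ ∧ h < h' then
        (y ⟨sampleRound I H n ρ ⟨_, hx.1⟩, Finset.mem_image_of_mem _
          (Finset.mem_filter.2 ⟨Finset.mem_univ _, hx.2⟩)⟩).1.2
      else (0, I.init)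
  have hlate : ∀ h' z' i, Measurable fun y => late y h' z' i := by
    intro h' z' i
    simp only [late]
    split_ifs
    · exact (measurable_pi_apply _).fst.snd
    · exact measurable_const
  let Y : (ℕ → Step I.State I.Action) → T → Step I.State I.Action := fun ω t => ω t
  let W : (ℕ → Step I.State I.Action) → Fin n → ℝ × I.State := fun ω i => (ω (k i)).1.2
  have hY : Measurable Y := measurable_pi_lambda _ fun _ => measurable_pi_apply _
  have hW : Measurable W := measurable_pi_lambda _ fun _ => (measurable_pi_apply _).fst.snd
  -- The value function is recovered from the rounds in `T` alone.
  have hvalue : ∀ ω, lsviValue I H n ρ (runData I H n ρ ω) j = lsviValue I H n ρ (late (Y ω)) j := by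
    intro ω
    funext s
    unfold lsviValue
    rw [lsviQ_congr (data' := late (Y ω)) hj.le fun h' hh' hh'' z' hz' i hi => ?_]
    have hx : (⟨h', z', i⟩ : Σ _ : ℕ, (I.State × I.Action) × ℕ) ∈ sampleSet I H n ρ :=
      mem_sampleSet.2 ⟨hh'', hz', hi⟩
    rw [runData_eq ω hx]
    simp only [late]
    rw [dif_pos ⟨hx, by omega⟩]
  have hWlaw : P.map W = Measure.pi fun _ => M.Q z := by
    have h1 := (iIndepFun_rounds I H n ρ M).precomp hk
    have h2 := h1.comp (fun _ x => x.1.2) fun _ => measurable_fst.snd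
    have h3 := (iIndepFun_iff_map_fun_eq_pi_map
      fun i => (measurable_fst.snd.comp (measurable_pi_apply _)).aemeasurable).1 h2
    refine h3.trans ?_
    congr 1
    funext i
    have h4 := map_answer I H n ρ M (k i)
    rw [queryAt_sampleRound] at h4
    exact h4
  have hindep : IndepFun Y W P := by
    have h1 := (iIndepFun_rounds I H n ρ M).indepFun_finset T S hdisj fun t => measurable_pi_apply t
    have h2 : Measurable fun (x : S → Step I.State I.Action) (i : Fin n) =>
        (x ⟨k i, Finset.mem_image_of_mem _ (Finset.mem_univ i)⟩).1.2 :=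
      measurable_pi_lambda _ fun _ => (measurable_pi_apply _).fst.snd
    exact h1.comp measurable_id h2
  have hjoint : P.map (fun ω => (Y ω, W ω)) = (P.map Y).prod (Measure.pi fun _ => M.Q z) := by
    rw [← hWlaw]
    exact (indepFun_iff_map_prod_eq_prod_map_map hY.aemeasurable hW.aemeasurable).1 hindep
  let g : (T → Step I.State I.Action) → ℝ × I.State → ℝ := fun y x =>
    x.1 + lsviValue I H n ρ (late y) j x.2
  have hg : Measurable fun p : (T → Step I.State I.Action) × (ℝ × I.State) => g p.1 p.2 :=
    measurable_snd.fst.add ((measurable_lsviValue I H n ρ hlate j).comp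
      (measurable_fst.prodMk measurable_snd.snd))
  let B : Set ((T → Step I.State I.Action) × (Fin n → ℝ × I.State)) :=
    {p | ε < |(1 / (n : ℝ)) * ∑ i, g p.1 (p.2 i) - lsviMean I H n ρ (late p.1) M j z|}
  have hB : MeasurableSet B := by
    refine measurableSet_lt measurable_const (Measurable.abs (Measurable.sub ?_ ?_))
    · refine measurable_const.mul (Finset.measurable_sum _ fun i _ => ?_)
      exact hg.comp (measurable_fst.prodMk ((measurable_pi_apply i).comp measurable_snd))
    · exact (measurable_lsviMean I H n ρ M hlate j z).comp measurable_fst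
  have hevent : {ω | ε < |lsviTarget I H n ρ (runData I H n ρ ω) j z -
      lsviMean I H n ρ (runData I H n ρ ω) M j z|} = (fun ω => (Y ω, W ω)) ⁻¹' B := by
    ext ω
    simp only [Set.mem_ofPred_eq, Set.mem_preimage, B, g, lsviTarget, lsviMean, hvalue,
      Finset.sum_range]
    have : ∀ i : Fin n, runData I H n ρ ω (H - (j + 1)) z i = W ω i := fun i =>
      runData_eq ω (hmem i)
    simp only [this]
  rw [hevent, ← Measure.map_apply (hY.prodMk hW) hB, hjoint, Measure.prod_apply hB]
  have hPY : IsProbabilityMeasure (P.map Y) := Measure.isProbabilityMeasure_map hY.aemeasurable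
  refine (lintegral_mono (g := fun _ => ENNReal.ofReal
    (2 * Real.exp (-(2 * n * ε ^ 2 / (2 * H + 1) ^ 2)))) fun y => ?_).trans
      (le_of_eq (by rw [lintegral_const, measure_univ, mul_one]))
  -- Rewards lie in `[0, 1]` and clipped values in `[-H, H]`, so the summands lie in an interval of
  -- length `2 H + 1`.
  have hsec := pi_abs_mean_sub_integral_gt_le (μ := M.Q z) (g := g y)
    (hg.comp (measurable_const.prodMk measurable_id)) (b := -H) (L := 2 * H + 1) (by positivity)
    (by
      filter_upwards [hM z] with x hx
      have := lsviValue_mem_Icc (I := I) (H := H) (n := n) (ρ := ρ) (data := late y) j x.2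
      exact ⟨by linarith [hx.1, this.1], by linarith [hx.2, this.2]⟩) hn hε
  rw [integral_reward_add_lsviValue I H n ρ hM] at hsec
  exact hsec

end Data

/-! ### The event that all regression targets are accurate -/

section Bad

variable {d : ℕ} (I : PlanningInput d) (H n : ℕ) (ρ : ℕ → (I.State × I.Action →₀ ℝ))
  (M : MDP I.State I.Action)

/-- The event that some regression target deviates by more than `ε` from its mean. -/
def deviationEvent (ε : ℝ) : Set (ℕ → Step I.State I.Action) :=
  ⋃ j ∈ Finset.range H, ⋃ z ∈ (ρ (H - (j + 1))).support,
    {ω | ε < |lsviTarget I H n ρ (runData I H n ρ ω) j z -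
      lsviMean I H n ρ (runData I H n ρ ω) M j z|}

theorem measurableSet_deviationEvent (ε : ℝ) : MeasurableSet (deviationEvent I H n ρ M ε) := by
  refine Finset.measurableSet_biUnion _ fun j _ => Finset.measurableSet_biUnion _ fun z _ => ?_
  have hdata := measurable_runData I H n ρ
  exact measurableSet_lt measurable_const ((measurable_lsviTarget I H n ρ hdata j z).sub
    (measurable_lsviMean I H n ρ M hdata j z)).abs

variable {I H n ρ M}

theorem abs_sub_le_of_notMem_deviationEvent {ε : ℝ} {ω : ℕ → Step I.State I.Action}
    (hω : ω ∉ deviationEvent I H n ρ M ε) {j : ℕ} (hj : j < H) {z : I.State × I.Action}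
    (hz : z ∈ (ρ (H - (j + 1))).support) :
    |lsviTarget I H n ρ (runData I H n ρ ω) j z -
      lsviMean I H n ρ (runData I H n ρ ω) M j z| ≤ ε := by
  by_contra h
  exact hω (Set.mem_biUnion (Finset.mem_coe.2 (Finset.mem_range.2 hj))
    (Set.mem_biUnion (Finset.mem_coe.2 hz) (not_le.1 h)))

theorem measure_deviationEvent_le (hn : 0 < n)
    (hM : ∀ z, ∀ᵐ x ∂(M.Q z), x.1 ∈ Set.Icc (0 : ℝ) 1) {ε : ℝ} (hε : 0 ≤ ε) {m : ℝ}
    (hm : ∀ h < H, ((ρ h).support.card : ℝ) ≤ m) :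
    lsviRun I H n ρ M (deviationEvent I H n ρ M ε) ≤
      ENNReal.ofReal (H * (m * (2 * Real.exp (-(2 * n * ε ^ 2 / (2 * H + 1) ^ 2))))) := by
  set p := 2 * Real.exp (-(2 * n * ε ^ 2 / (2 * H + 1) ^ 2)) with hp
  have hp0 : 0 ≤ p := by positivity
  calc lsviRun I H n ρ M (deviationEvent I H n ρ M ε)
      ≤ ∑ j ∈ Finset.range H, ∑ z ∈ (ρ (H - (j + 1))).support, ENNReal.ofReal p := by
        refine (measure_biUnion_finset_le _ _).trans (Finset.sum_le_sum fun j hj => ?_)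
        refine (measure_biUnion_finset_le _ _).trans (Finset.sum_le_sum fun z hz => ?_)
        exact measure_lsviTarget_deviation_le hn hM hε (Finset.mem_range.1 hj) hz
    _ ≤ ∑ j ∈ Finset.range H, ENNReal.ofReal (m * p) := by
        refine Finset.sum_le_sum fun j hj => ?_
        have hj' := Finset.mem_range.1 hj
        rw [Finset.sum_const, nsmul_eq_mul, ← ENNReal.ofReal_natCast,
          ← ENNReal.ofReal_mul (Nat.cast_nonneg _)]
        exact ENNReal.ofReal_le_ofReal (mul_le_mul_of_nonneg_right (hm _ (by omega)) hp0)
    _ = ENNReal.ofReal (H * (m * p)) := by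
        rw [Finset.sum_const, nsmul_eq_mul, Finset.card_range, ENNReal.ofReal_mul (Nat.cast_nonneg _),
          ENNReal.ofReal_natCast]

theorem lastRound_add_one_le (hn : 0 < n) (hH : 0 < H) {m : ℝ} (hm1 : 1 ≤ m)
    (hm : ∀ h < H, ((ρ h).support.card : ℝ) ≤ m) :
    ((lastRound I H n ρ + 1 : ℕ) : ℝ) ≤ H * m * n := by
  have hcard : ((sampleSet I H n ρ).card : ℝ) ≤ H * m * n := by
    rw [sampleSet, Finset.card_sigma]
    push_cast
    calc ∑ h ∈ Finset.range H, (((ρ h).support ×ˢ Finset.range n).card : ℝ)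
        ≤ ∑ h ∈ Finset.range H, m * n := by
          refine Finset.sum_le_sum fun h hh => ?_
          rw [Finset.card_product, Finset.card_range]
          push_cast
          exact mul_le_mul_of_nonneg_right (hm h (Finset.mem_range.1 hh)) (Nat.cast_nonneg n)
      _ = H * m * n := by simp [mul_assoc]
  -- Even with nothing to collect, a run makes one query before it stops; `1 ≤ m` covers this case.
  rcases Nat.eq_zero_or_pos (sampleSet I H n ρ).card with h0 | h0
  · have hn' : (1 : ℝ) ≤ n := by exact_mod_cast hn
    have hH' : (1 : ℝ) ≤ H := by exact_mod_cast hH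
    have h1 : 1 ≤ H * m := by nlinarith
    rw [lastRound, h0]
    push_cast
    nlinarith
  · rw [lastRound, Nat.sub_add_cancel h0]
    exact hcard

end Bad

/-! ### Greedy policies -/

theorem isPolicy_ite {S A : Type} [MeasurableSpace S] [MeasurableSpace A] [MeasurableSingletonClass A]
    [Fintype A] [DecidableEq A] {c : ℕ → S → A} (hc : ∀ h, Measurable (c h)) :
    MDP.IsPolicy fun h s a => if c h s = a then (1 : ℝ) else 0 where
  measurable h a := Measurable.ite (hc h (measurableSet_singleton a)) measurable_const
    measurable_const
  nonneg h s a := by split_ifs <;> norm_num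
  sum_eq_one h s := by simp

section Planner

variable {H d n : ℕ} {X : Problem H d} {D : DesignRule d} {τ : ArgmaxRule} {K ε : ℝ}

/-- The action that least-squares value iteration takes after the run `ω`. -/
noncomputable def greedyAction (X : Problem H d) (D : DesignRule d) (τ : ArgmaxRule) (n : ℕ)
    (ω : ℕ → Step X.input.State X.input.Action) (h : ℕ) (s : X.input.State) : X.input.Action :=
  τ.choose X.input.actionsPred
    (lsviQ X.input H n (D X.input) (runData X.input H n (D X.input) ω) (H - h) s)

theorem measurable_greedyAction (X : Problem H d) (D : DesignRule d) (τ : ArgmaxRule) (n h : ℕ) :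
    Measurable fun p : (ℕ → Step X.input.State X.input.Action) × X.input.State =>
      greedyAction X D τ n p.1 h p.2 :=
  (τ.measurable_choose _).comp <| measurable_pi_lambda _ fun a =>
    measurable_lsviQ X.input H n (D X.input) _ (measurable_runData X.input H n (D X.input)) (H - h) a

theorem loss_greedyAction_le (hd : 1 ≤ d)
    (hD : ∀ h < H, IsNearOptimalDesign K (X.input.feature h) (X.input.pairs h) (D X.input h))
    (hε : 0 ≤ ε) {ω : ℕ → Step X.input.State X.input.Action}
    (hω : ω ∉ deviationEvent X.input H n (D X.input) X.mdp ε) {j : ℕ} (hj : j < H)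
    {s : X.input.State} (hs : s ∈ X.mdp.reach (H - (j + 1))) :
    (⨆ a, X.mdp.optQ (j + 1) s a) -
        X.mdp.optQ (j + 1) s (greedyAction X D τ n ω (H - (j + 1)) s) ≤
      8 * ε * √(2 * d) ^ (j + 1) := by
  have h := iSup_optQ_sub_optQ_le_of_greedy hd hD hε
    (fun j hj z hz => abs_sub_le_of_notMem_deviationEvent hω hj hz) (show j + 1 ≤ H from hj) hs τ
  rwa [greedyAction, show H - (H - (j + 1)) = j + 1 by omega]

/-! ### Global soundness -/

open Classical in
/-- The suboptimality gap of the greedy policy after the run `ω`. -/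
noncomputable def greedyGap (X : Problem H d) (D : DesignRule d) (τ : ArgmaxRule) (n : ℕ)
    (ω : ℕ → Step X.input.State X.input.Action) : ℝ≥0∞ :=
  X.mdp.suboptimality H fun h s a => if greedyAction X D τ n ω h s = a then 1 else 0

theorem greedyGap_le_horizon (X : Problem H d) (D : DesignRule d) (τ : ArgmaxRule) (n : ℕ)
    (ω : ℕ → Step X.input.State X.input.Action) :
    greedyGap X D τ n ω ≤ ENNReal.ofReal H := by
  classical
  exact MDP.suboptimality_le_horizon X.bounded (isPolicy_ite fun h =>
    (measurable_greedyAction X D τ n h).comp (measurable_const.prodMk measurable_id)) H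

theorem greedyGap_le (hd : 1 ≤ d)
    (hD : ∀ h < H, IsNearOptimalDesign K (X.input.feature h) (X.input.pairs h) (D X.input h))
    (hε : 0 ≤ ε) {ω : ℕ → Step X.input.State X.input.Action}
    (hω : ω ∉ deviationEvent X.input H n (D X.input) X.mdp ε) :
    greedyGap X D τ n ω ≤ ENNReal.ofReal (32 * ε * √(2 * d) ^ H) := by
  classical
  refine MDP.suboptimality_le_of_loss_le (β := fun j => 8 * ε * √(2 * d) ^ (j + 1)) X.bounded
    (isPolicy_ite fun h =>
      (measurable_greedyAction X D τ n h).comp (measurable_const.prodMk measurable_id))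
    (fun j hj s hs => ?_) fun j hj => sum_pow_sqrt_le hd hε hj
  simp only [ite_mul, one_mul, zero_mul, Finset.sum_ite_eq, Finset.mem_univ, if_true]
  exact loss_greedyAction_le hd hD hε hω hj hs

theorem gap_le_greedyGap {ω : ℕ → Step X.input.State X.input.Action}
    (hω : StopsAt ω (lastRound X.input H n (D X.input))) :
    (lsvi D τ H n).gap X ω ≤ greedyGap X D τ n ω :=
  iInf₂_le (lastRound X.input H n (D X.input)) hω

/-- Off the exceptional event `E` the gap is at most `B`; on `E` it is at most the horizon, which
adds `H * η` to the expectation. -/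
theorem isGloballySound_lsvi {𝓜 : Set (Problem H d)} {δ B η : ℝ} (hB : 0 ≤ B) (hη : 0 ≤ η)
    (hBη : B + H * η ≤ δ) (hη2 : η ≤ δ / 2)
    (hbad : ∀ X ∈ 𝓜, ∃ E, MeasurableSet E ∧
      lsviRun X.input H n (D X.input) X.mdp E ≤ ENNReal.ofReal η ∧
      ∀ ω ∉ E, greedyGap X D τ n ω ≤ ENNReal.ofReal B) :
    (lsvi D τ H n).IsGloballySound 𝓜 δ where
  wellFormed X _ := (ae_stopsAt_lastRound X.input H n (D X.input) X.mdp).mono fun _ h => ⟨_, h⟩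
  expected X hX := by
    classical
    obtain ⟨E, hE, hPE, hgap⟩ := hbad X hX
    let F := {ω : ℕ → Step X.input.State X.input.Action |
      StopsAt ω (lastRound X.input H n (D X.input))}
    have hF : MeasurableSet F := measurableSet_stopsAt _
    -- The gap is dominated by a measurable function that equals `∞` off the full-measure event of
    -- stopping at the expected round, where the gap is not controlled.
    refine ⟨fun ω => if ω ∈ F then ENNReal.ofReal B + E.indicator (fun _ => ENNReal.ofReal H) ω
      else ∞, ?_, ?_, ?_⟩
    · exact Measurable.ite hF ((measurable_const.indicator hE).const_add _) measurable_const
    · intro ω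
      dsimp only
      split_ifs with h
      · refine (gap_le_greedyGap h).trans ?_
        by_cases hωE : ω ∈ E
        · rw [Set.indicator_of_mem hωE]
          exact (greedyGap_le_horizon X D τ n ω).trans le_add_self
        · exact (hgap ω hωE).trans le_self_add
      · exact le_top
    · have hae : (fun ω => if ω ∈ F then ENNReal.ofReal B +
          E.indicator (fun _ => ENNReal.ofReal H) ω else ∞) =ᵐ[lsviRun X.input H n (D X.input) X.mdp]
          fun ω => ENNReal.ofReal B + E.indicator (fun _ => ENNReal.ofReal H) ω := by
        filter_upwards [ae_stopsAt_lastRound X.input H n (D X.input) X.mdp] with ω hω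
        exact if_pos hω
      refine (lintegral_congr_ae hae).trans_le ?_
      rw [lintegral_add_left measurable_const, lintegral_const, measure_univ, mul_one,
        lintegral_indicator_const hE]
      calc ENNReal.ofReal B + ENNReal.ofReal H * lsviRun X.input H n (D X.input) X.mdp E
          ≤ ENNReal.ofReal B + ENNReal.ofReal H * ENNReal.ofReal η := by gcongr
        _ = ENNReal.ofReal (B + H * η) := by
            rw [← ENNReal.ofReal_mul (Nat.cast_nonneg H), ENNReal.ofReal_add hB (by positivity)]
        _ ≤ ENNReal.ofReal δ := ENNReal.ofReal_le_ofReal hBη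
  highProb X hX := by
    obtain ⟨E, hE, hPE, hgap⟩ := hbad X hX
    refine le_trans (measure_mono_ae ?_) (hPE.trans (ENNReal.ofReal_le_ofReal hη2))
    filter_upwards [ae_stopsAt_lastRound X.input H n (D X.input) X.mdp] with ω hω hgt
    by_contra hωE
    refine (lt_irrefl (ENNReal.ofReal δ)) ((show ENNReal.ofReal δ < _ from hgt).trans_le ?_)
    refine (gap_le_greedyGap hω).trans ((hgap ω hωE).trans (ENNReal.ofReal_le_ofReal ?_))
    nlinarith [mul_nonneg (Nat.cast_nonneg (α := ℝ) H) hη]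

/-! ### Local soundness -/

/-- Almost surely only the term of the stopping round contributes, and the output there is
deterministic. -/
theorem actionProb_lsvi (X : Problem H d) (D : DesignRule d) (τ : ArgmaxRule) (n h : ℕ)
    (s : X.input.State) (a : X.input.Action) :
    ((lsvi D τ H n).toPlanner X.input h s).actionProb X.mdp a =
      lsviRun X.input H n (D X.input) X.mdp {ω | greedyAction X D τ n ω h s = a} := by
  classical
  have hmeas : MeasurableSet {ω | greedyAction X D τ n ω h s = a} :=
    ((measurable_greedyAction X D τ n h).comp (measurable_id.prodMk measurable_const))
      (measurableSet_singleton a)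
  rw [← lintegral_indicator_one hmeas]
  refine lintegral_congr_ae ?_
  filter_upwards [ae_stopsAt_lastRound X.input H n (D X.input) X.mdp] with ω hω
  rw [tsum_eq_single (lastRound X.input H n (D X.input)) fun t ht =>
    if_neg fun h => ht (h.unique hω), if_pos hω]
  exact Kernel.deterministic_apply' (((lsvi D τ H n).measurable_readout X.input
    (lastRound X.input H n (D X.input) + 1) h).comp (measurable_id.prodMk measurable_const)) _
    (measurableSet_singleton a)

theorem policy_lsvi (X : Problem H d) (D : DesignRule d) (τ : ArgmaxRule) (n h : ℕ)
    (s : X.input.State) (a : X.input.Action) :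
    (lsvi D τ H n).toPlanner.policy X h s a =
      (lsviRun X.input H n (D X.input) X.mdp).real {ω | greedyAction X D τ n ω h s = a} := by
  rw [Planner.policy, actionProb_lsvi]
  rfl

/-- The local policy is the law of the greedy action, so averaging over actions is averaging over
runs. -/
theorem sum_policy_mul_eq_integral (X : Problem H d) (D : DesignRule d) (τ : ArgmaxRule) (n h : ℕ)
    (s : X.input.State) (x : X.input.Action → ℝ) :
    ∑ a, (lsvi D τ H n).toPlanner.policy X h s a * x a =
      ∫ ω, x (greedyAction X D τ n ω h s) ∂(lsviRun X.input H n (D X.input) X.mdp) := by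
  have hc : Measurable fun ω => greedyAction X D τ n ω h s :=
    (measurable_greedyAction X D τ n h).comp (measurable_id.prodMk measurable_const)
  have hx : Measurable x := measurable_of_finite x
  rw [← integral_map (φ := fun ω => greedyAction X D τ n ω h s) hc.aemeasurable
    hx.aestronglyMeasurable]
  have : IsProbabilityMeasure ((lsviRun X.input H n (D X.input) X.mdp).map fun ω =>
    greedyAction X D τ n ω h s) := Measure.isProbabilityMeasure_map hc.aemeasurable
  rw [integral_fintype (Integrable.of_finite)]
  refine Finset.sum_congr rfl fun a _ => ?_
  rw [policy_lsvi, smul_eq_mul, map_measureReal_apply hc (measurableSet_singleton a)]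
  rfl

theorem isPolicy_lsvi (X : Problem H d) (D : DesignRule d) (τ : ArgmaxRule) (n : ℕ) :
    MDP.IsPolicy ((lsvi D τ H n).toPlanner.policy X) where
  measurable h a := by
    simp only [policy_lsvi, Measure.real]
    have hset : MeasurableSet {p : X.input.State × (ℕ → Step X.input.State X.input.Action) |
        greedyAction X D τ n p.2 h p.1 = a} :=
      ((measurable_greedyAction X D τ n h).comp measurable_swap) (measurableSet_singleton a)
    exact (measurable_measure_prodMk_left hset).ennreal_toReal
  nonneg h s a := ENNReal.toReal_nonneg
  sum_eq_one h s := by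
    simpa using sum_policy_mul_eq_integral X D τ n h s fun _ => 1

theorem isSound_lsvi_of_suboptimality_le {𝓜 : Set (Problem H d)} {δ : ℝ}
    (h : ∀ X ∈ 𝓜, X.mdp.suboptimality H ((lsvi D τ H n).toPlanner.policy X) ≤ ENNReal.ofReal δ) :
    (lsvi D τ H n).toPlanner.IsSound 𝓜 δ where
  wellFormed X _ _ _ _ _ :=
    (ae_stopsAt_lastRound X.input H n (D X.input) X.mdp).mono fun _ h => ⟨_, h⟩
  measurable X _ h _ a := (isPolicy_lsvi X D τ n).measurable h a
  subopt_le := h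

/-- Each call is a fresh run that fails with probability at most `η` and then loses at most `H` in
that stage. Summation over the stages turns the failure term into `H * (H * η)`. -/
theorem suboptimality_lsvi_le (hd : 1 ≤ d)
    (hD : ∀ h < H, IsNearOptimalDesign K (X.input.feature h) (X.input.pairs h) (D X.input h))
    (hε : 0 ≤ ε) {η : ℝ} (hη : 0 ≤ η)
    (hP : lsviRun X.input H n (D X.input) X.mdp (deviationEvent X.input H n (D X.input) X.mdp ε) ≤
      ENNReal.ofReal η) :
    X.mdp.suboptimality H ((lsvi D τ H n).toPlanner.policy X) ≤
      ENNReal.ofReal (32 * ε * √(2 * d) ^ H + H * (H * η)) := by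
  set P := lsviRun X.input H n (D X.input) X.mdp with hPdef
  set E := deviationEvent X.input H n (D X.input) X.mdp ε with hE
  have hEm : MeasurableSet E := measurableSet_deviationEvent _ _ _ _ _ _
  refine MDP.suboptimality_le_of_loss_le (β := fun j => 8 * ε * √(2 * d) ^ (j + 1) + H * η) X.bounded
    (isPolicy_lsvi X D τ n) (fun j hj s hs => ?_) fun j hj => ?_
  · set x : X.input.Action → ℝ := fun a =>
      (⨆ a', X.mdp.optQ (j + 1) s a') - X.mdp.optQ (j + 1) s a with hx
    set b := 8 * ε * √(2 * d) ^ (j + 1) with hb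
    have hb0 : 0 ≤ b := by positivity
    have hxm : ∀ a, x a ∈ Set.Icc (0 : ℝ) H := by
      intro a
      have h1 := MDP.optQ_mem_Icc X.bounded (j + 1) s
      have h2 := (iSup_mem_Icc h1).2
      have h3 := le_iSup_of_finite (X.mdp.optQ (j + 1) s) a
      have h4 : ((j + 1 : ℕ) : ℝ) ≤ H := by exact_mod_cast hj
      constructor
      · simp only [hx]; linarith
      · simp only [hx]; linarith [(h1 a).1]
    have hc : Measurable fun ω => greedyAction X D τ n ω (H - (j + 1)) s :=
      (measurable_greedyAction X D τ n _).comp (measurable_id.prodMk measurable_const)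
    have hi1 : Integrable (fun ω => x (greedyAction X D τ n ω (H - (j + 1)) s)) P :=
      integrable_of_mem_Icc ((measurable_of_finite x).comp hc) fun ω => hxm _
    have hi2 : Integrable (fun ω => E.indicator (fun _ => (H : ℝ)) ω) P :=
      (integrable_const _).indicator hEm
    rw [sum_policy_mul_eq_integral X D τ n _ s x, ← hPdef]
    calc ∫ ω, x (greedyAction X D τ n ω (H - (j + 1)) s) ∂P
        ≤ ∫ ω, (b + E.indicator (fun _ => (H : ℝ)) ω) ∂P := by
          refine integral_mono hi1 ((integrable_const b).add hi2) fun ω => ?_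
          by_cases hω : ω ∈ E
          · simp only [Set.indicator_of_mem hω]
            linarith [(hxm (greedyAction X D τ n ω (H - (j + 1)) s)).2]
          · simp only [Set.indicator_of_notMem hω, add_zero]
            exact loss_greedyAction_le hd hD hε hω hj hs
      _ = b + P.real E * H := by
          rw [integral_add (integrable_const b) hi2, integral_indicator_const _ hEm]
          simp
      _ ≤ b + H * η := by
          have : P.real E ≤ η := ENNReal.toReal_le_of_le_ofReal hη hP
          nlinarith [(Nat.cast_nonneg H : (0 : ℝ) ≤ H)]
  · rw [Finset.sum_add_distrib, Finset.sum_const, Finset.card_range, nsmul_eq_mul]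
    have hj' : (j : ℝ) ≤ H := by exact_mod_cast hj
    exact add_le_add (sum_pow_sqrt_le hd hε hj)
      (mul_le_mul_of_nonneg_right hj' (by positivity))

/-! ### Query cost -/

theorem queryCost_lsvi_le {𝓜 : Set (Problem H d)} {B : ℝ}
    (hB : ∀ X ∈ 𝓜, ((lastRound X.input H n (D X.input) + 1 : ℕ) : ℝ) ≤ B) :
    (lsvi D τ H n).toPlanner.queryCost 𝓜 ≤ ENNReal.ofReal B := by
  refine iSup₂_le fun X hX => iSup₂_le fun h _ => iSup₂_le fun s _ => ?_
  have hle : ∀ᵐ ω ∂(lsviRun X.input H n (D X.input) X.mdp), numQueries ω ≤ ENNReal.ofReal B := by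
    filter_upwards [ae_stopsAt_lastRound X.input H n (D X.input) X.mdp] with ω hω
    refine (iInf₂_le _ hω).trans ?_
    rw [← ENNReal.ofReal_natCast]
    exact ENNReal.ofReal_le_ofReal (hB X hX)
  refine (lintegral_mono_ae hle).trans ?_
  rw [lintegral_const, measure_univ, mul_one]

end Planner

/-! ### Sample sizes -/

theorem exists_near_optimal_rule (H : ℕ) {d : ℕ} (hd : 1 ≤ d) :
    ∃ D : DesignRule d, D.IsNearOptimal 2 H := by
  classical
  -- Existence of a design depends only on what the planner is told, so this is a legitimate rule;
  -- the default `0` never occurs on the problems considered.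
  refine ⟨fun I h => if hex : ∃ ρ, IsNearOptimalDesign 2 (I.feature h) (I.pairs h) ρ then
    hex.choose else 0, fun X hX h hh => ?_⟩
  have hne : (X.input.pairs h).Nonempty := by
    obtain ⟨s, hs⟩ := X.mdp.reach_nonempty h
    rw [← X.stage_eq h hh.le] at hs
    exact ⟨(s, 0), hs⟩
  have hex := exists_isNearOptimalDesign hd hne (hX h hh)
  simp only [dif_pos hex]
  exact hex.choose_spec

section Numeric

variable {H d n : ℕ} {δ : ℝ}

theorem one_le_log_two_add (hd : 1 ≤ d) (hδ : 0 < δ) (hδH : δ ≤ H) :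
    1 ≤ Real.log (2 + H * d / δ) := by
  have hd' : (1 : ℝ) ≤ d := by exact_mod_cast hd
  have h1 : 1 ≤ H * d / δ := by
    rw [le_div_iff₀ hδ]
    nlinarith
  have he := Real.exp_one_lt_d9
  rw [Real.le_log_iff_exp_le (by linarith)]
  linarith

theorem natCast_le_mul_div (hδ : 0 < δ) (hδH : δ ≤ H) : (d : ℝ) ≤ H * d / δ := by
  rw [le_div_iff₀ hδ, mul_comm]
  exact mul_le_mul_of_nonneg_right hδH (Nat.cast_nonneg d)

theorem log_log_le_log (hd : 1 ≤ d) : Real.log (Real.log d) ≤ Real.log d :=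
  Real.log_le_self (Real.log_nonneg (by exact_mod_cast hd))

/-- The number of design points is of the order `d log (2 + H d / δ)`. -/
theorem design_card_le_log (hd : 1 ≤ d) (hδ : 0 < δ) (hδH : δ ≤ H) :
    2 * (4 * d * Real.log (Real.log d) + 16) ≤ 40 * d * Real.log (2 + H * d / δ) := by
  have hd' : (1 : ℝ) ≤ d := by exact_mod_cast hd
  have hL := one_le_log_two_add hd hδ hδH
  have h1 : Real.log d ≤ Real.log (2 + H * d / δ) :=
    Real.log_le_log (by linarith) (by linarith [natCast_le_mul_div (d := d) hδ hδH])
  have h2 : Real.log (Real.log d) ≤ Real.log (2 + H * d / δ) := (log_log_le_log hd).trans h1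
  have h3 : (d : ℝ) * Real.log (Real.log d) ≤ d * Real.log (2 + H * d / δ) := by gcongr
  have h4 : 1 ≤ d * Real.log (2 + H * d / δ) := by nlinarith
  linarith

/-- A crude bound without logarithms, sufficient inside the union bound. -/
theorem design_card_le_sq (hd : 1 ≤ d) :
    2 * (4 * d * Real.log (Real.log d) + 16) ≤ 40 * (d : ℝ) ^ 2 := by
  have hd' : (1 : ℝ) ≤ d := by exact_mod_cast hd
  have h2 : Real.log (Real.log d) ≤ d :=
    (log_log_le_log hd).trans (Real.log_le_self (by linarith))
  nlinarith

/-- The union bound over all design points, with `n` samples for each. -/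
theorem union_bound_le (hH : 1 ≤ H) (hd : 1 ≤ d) (hδ : 0 < δ) (hδH : δ ≤ H)
    (hn : 165888 * ((H : ℝ) ^ 4 * (2 * (d : ℝ)) ^ H / δ ^ 2) * Real.log (2 + H * d / δ) ≤ n) :
    H * (2 * (4 * d * Real.log (Real.log d) + 16) *
        (2 * Real.exp (-(2 * n * (δ / (64 * √(2 * d) ^ H)) ^ 2 / (2 * H + 1) ^ 2)))) ≤
      δ / (2 * H ^ 2) := by
  have hd' : (1 : ℝ) ≤ d := by exact_mod_cast hd
  have hH' : (1 : ℝ) ≤ H := by exact_mod_cast hH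
  set x := 2 + H * d / δ with hx
  have hdx : (d : ℝ) ≤ H * d / δ := natCast_le_mul_div hδ hδH
  have hx3 : 3 ≤ x := by linarith
  have hL0 : 0 ≤ Real.log x := Real.log_nonneg (by linarith)
  set E := 2 * n * (δ / (64 * √(2 * d) ^ H)) ^ 2 / (2 * H + 1) ^ 2 with hE
  have hs : (√(2 * d) ^ H) ^ 2 = (2 * (d : ℝ)) ^ H := by
    rw [← pow_mul, mul_comm H 2, pow_mul, Real.sq_sqrt (by positivity)]
  have hEn : E = n * (2 * δ ^ 2 / (4096 * (2 * (d : ℝ)) ^ H * (2 * H + 1) ^ 2)) := by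
    rw [hE, div_pow, mul_pow, hs]
    field_simp
    ring
  -- The constant solves `165888 * 2 / (4096 * 9) = 9`: `4096 = 64 ^ 2` comes from `ε` and `9` from
  -- `2 H + 1 ≤ 3 H`.
  have hexp : (9 * H ^ 2 : ℝ) * Real.log x ≤ E := by
    have hY : 0 < (2 * (d : ℝ)) ^ H := by positivity
    calc (9 * H ^ 2 : ℝ) * Real.log x
        = 165888 * ((H : ℝ) ^ 4 * (2 * (d : ℝ)) ^ H / δ ^ 2) * Real.log x *
            (2 * δ ^ 2 / (4096 * (2 * (d : ℝ)) ^ H * (3 * H) ^ 2)) := by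
          field_simp
          ring
      _ ≤ 165888 * ((H : ℝ) ^ 4 * (2 * (d : ℝ)) ^ H / δ ^ 2) * Real.log x *
            (2 * δ ^ 2 / (4096 * (2 * (d : ℝ)) ^ H * (2 * H + 1) ^ 2)) := by
          gcongr
          linarith
      _ ≤ n * (2 * δ ^ 2 / (4096 * (2 * (d : ℝ)) ^ H * (2 * H + 1) ^ 2)) := by gcongr
      _ = E := hEn.symm
  have hpow : x ^ (9 * H ^ 2) ≤ Real.exp E := by
    have h1 : x ^ (9 * H ^ 2) = Real.exp ((9 * H ^ 2 : ℝ) * Real.log x) := by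
      rw [show (9 * (H : ℝ) ^ 2) = ((9 * H ^ 2 : ℕ) : ℝ) by push_cast; ring, ← Real.log_pow,
        Real.exp_log (by positivity)]
    rw [h1]
    exact Real.exp_le_exp.2 hexp
  -- When `δ` is comparable to `H`, the base `x` alone does not control `H`. The factor `H ^ 2` in
  -- the exponent makes up for this, through `H ≤ 2 ^ H ≤ x ^ H`.
  have hbase : 160 * H ^ 3 * (d : ℝ) ^ 2 / δ ≤ x ^ (9 * H ^ 2) := by
    have h160 : (160 : ℝ) ≤ x ^ 5 := by
      calc (160 : ℝ) ≤ 3 ^ 5 := by norm_num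
        _ ≤ x ^ 5 := by gcongr
    have hHx : (H : ℝ) ≤ x ^ H := by
      have h2 : (H : ℝ) ≤ 2 ^ H := by exact_mod_cast Nat.lt_two_pow_self.le
      exact h2.trans (by gcongr; linarith)
    have hHx2 : (H : ℝ) ^ 2 ≤ x ^ (2 * H) := by
      rw [mul_comm 2 H, pow_mul]
      gcongr
    have hdd : H * (d : ℝ) ^ 2 / δ ≤ x ^ 2 := by
      calc H * (d : ℝ) ^ 2 / δ = H * d / δ * d := by ring
        _ ≤ x * x := mul_le_mul (by linarith) (by linarith) (by linarith) (by linarith)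
        _ = x ^ 2 := by ring
    calc 160 * H ^ 3 * (d : ℝ) ^ 2 / δ = 160 * (H : ℝ) ^ 2 * (H * (d : ℝ) ^ 2 / δ) := by ring
      _ ≤ x ^ 5 * x ^ (2 * H) * x ^ 2 := by gcongr
      _ = x ^ (5 + 2 * H + 2) := by rw [← pow_add, ← pow_add]
      _ ≤ x ^ (9 * H ^ 2) := pow_le_pow_right₀ (by linarith) (by nlinarith)
  have hfin : 160 * H ^ 3 * (d : ℝ) ^ 2 / δ * Real.exp (-E) ≤ 1 := by
    rw [Real.exp_neg]
    exact mul_inv_le_one_of_le₀ (hbase.trans hpow) (Real.exp_pos E).le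
  calc H * (2 * (4 * d * Real.log (Real.log d) + 16) * (2 * Real.exp (-E)))
      ≤ H * (40 * (d : ℝ) ^ 2 * (2 * Real.exp (-E))) :=
        mul_le_mul_of_nonneg_left (mul_le_mul_of_nonneg_right (design_card_le_sq hd) (by positivity))
          (by positivity)
    _ = (160 * H ^ 3 * (d : ℝ) ^ 2 / δ * Real.exp (-E)) * (δ / (2 * H ^ 2)) := by
        field_simp
        norm_num
    _ ≤ δ / (2 * H ^ 2) := mul_le_of_le_one_left (by positivity) hfin

/-- The total number of queries. -/
theorem total_queries_le (hH : 1 ≤ H) (hd : 1 ≤ d) (hδ : 0 < δ) (hδH : δ ≤ H)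
    (hn : (n : ℝ) <
      165888 * ((H : ℝ) ^ 4 * (2 * (d : ℝ)) ^ H / δ ^ 2) * Real.log (2 + H * d / δ) + 1) :
    H * (2 * (4 * d * Real.log (Real.log d) + 16)) * n ≤
      3317780 * ((H : ℝ) ^ 5 * (2 * (d : ℝ)) ^ (H + 1) / δ ^ 2) *
        Real.log (2 + H * d / δ) ^ 2 := by
  have hd' : (1 : ℝ) ≤ d := by exact_mod_cast hd
  have hH' : (1 : ℝ) ≤ H := by exact_mod_cast hH
  have hL := one_le_log_two_add hd hδ hδH
  have hm := design_card_le_log hd hδ hδH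
  set L := Real.log (2 + H * d / δ) with hLdef
  set Y := (H : ℝ) ^ 4 * (2 * (d : ℝ)) ^ H / δ ^ 2 with hY
  have hY1 : 1 ≤ Y := by
    rw [hY, le_div_iff₀ (by positivity), one_mul]
    calc δ ^ 2 ≤ (H : ℝ) ^ 2 := by gcongr
      _ ≤ (H : ℝ) ^ 4 := pow_le_pow_right₀ hH' (by norm_num)
      _ ≤ (H : ℝ) ^ 4 * (2 * (d : ℝ)) ^ H :=
          le_mul_of_one_le_right (by positivity) (one_le_pow₀ (by linarith))
  have hYL : 1 ≤ Y * L := by nlinarith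
  -- Since `1 ≤ Y * L`, rounding up costs at most one more multiple of `Y * L`.
  have hn' : (n : ℝ) ≤ 165889 * (Y * L) := by linarith
  calc H * (2 * (4 * d * Real.log (Real.log d) + 16)) * n
      ≤ H * (40 * d * L) * (165889 * (Y * L)) := by gcongr
    -- The constant is `40 * 165889 / 2`; the division by `2` is due to the additional factor `2 d`
    -- in `(2 d) ^ (H + 1)`.
    _ = 3317780 * ((H : ℝ) ^ 5 * (2 * (d : ℝ)) ^ (H + 1) / δ ^ 2) * L ^ 2 := by
        rw [hY]
        ring

end Numeric

end QPlanning

/-! ### Choice of the constants and conclusion -/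

open QPlanning in
theorem proposition3 :
    ∃ K C₁ C₂ : ℝ, 1 ≤ K ∧ 0 < C₁ ∧ 0 < C₂ ∧ ∀ H d : ℕ, 1 ≤ H → 1 ≤ d →
      (∃ D : DesignRule d, D.IsNearOptimal K H) ∧
      ∀ D : DesignRule d, D.IsNearOptimal K H → ∀ (τ : ArgmaxRule) (δ : ℝ), 0 < δ →
        ∀ n : ℕ,
          n = ⌈C₁ * ((H : ℝ) ^ 4 * (2 * (d : ℝ)) ^ H / δ ^ 2) * Real.log (2 + H * d / δ)⌉₊ →
          (lsvi D τ H n).toPlanner.IsSound (compactProblems H d) δ ∧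
          (lsvi D τ H n).IsGloballySound (compactProblems H d) δ ∧
          (δ ≤ H →
            (lsvi D τ H n).toPlanner.queryCost (compactProblems H d) ≤
              ENNReal.ofReal (C₂ * ((H : ℝ) ^ 5 * (2 * (d : ℝ)) ^ (H + 1) / δ ^ 2) *
                Real.log (2 + H * d / δ) ^ 2)) := by
  refine ⟨2, 165888, 3317780, by norm_num, by norm_num, by norm_num, fun H d hH hd =>
    ⟨exists_near_optimal_rule H hd, fun D hD τ δ hδ n hn => ?_⟩⟩
  have hH' : (1 : ℝ) ≤ H := by exact_mod_cast hH
  have hd' : (1 : ℝ) ≤ d := by exact_mod_cast hd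
  have hL : 0 < Real.log (2 + H * d / δ) := by
    have : 0 ≤ H * d / δ := by positivity
    exact Real.log_pos (by linarith)
  set N := 165888 * ((H : ℝ) ^ 4 * (2 * (d : ℝ)) ^ H / δ ^ 2) * Real.log (2 + H * d / δ) with hN
  have hN0 : 0 < N := by positivity
  have hnpos : 0 < n := hn ▸ Nat.ceil_pos.2 hN0
  have hnN : N ≤ n := hn ▸ Nat.le_ceil N
  have hnN1 : (n : ℝ) < N + 1 := hn ▸ Nat.ceil_lt_add_one hN0.le
  have hcard : ∀ X ∈ compactProblems H d, ∀ h < H,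
      ((D X.input h).support.card : ℝ) ≤ 2 * (4 * d * Real.log (Real.log d) + 16) :=
    fun X hX h hh => (hD X hX h hh).card_le
  have hm1 : 1 ≤ 2 * (4 * d * Real.log (Real.log d) + 16) := by
    linarith [natCast_le_mul_log_log hd]
  -- If `δ > H`, the trivial bound of the gap by the horizon already gives soundness, and the cost
  -- bound is not claimed.
  rcases le_or_gt δ H with hδH | hδH
  -- With this `ε` the accumulated greedy loss is `δ / 2`; with this `η` the failures of the local
  -- planner cost another `δ / 2`.
  · set ε := δ / (64 * √(2 * d) ^ H) with hε
    set η := δ / (2 * (H : ℝ) ^ 2) with hη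
    have hs0 : 0 < √(2 * (d : ℝ)) ^ H := by positivity
    have hε0 : 0 ≤ ε := by positivity
    have hη0 : 0 ≤ η := by positivity
    have hB : 32 * ε * √(2 * d) ^ H = δ / 2 := by
      rw [hε]
      field_simp
      norm_num
    have hHHη : H * (H * η) = δ / 2 := by
      rw [hη]
      field_simp
    have hHη : η ≤ H * η := le_mul_of_one_le_left hη0 hH'
    have hHη2 : H * η ≤ δ / 2 :=
      hHHη ▸ le_mul_of_one_le_left (by positivity) hH'
    have hbad : ∀ X ∈ compactProblems H d, lsviRun X.input H n (D X.input) X.mdp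
        (deviationEvent X.input H n (D X.input) X.mdp ε) ≤ ENNReal.ofReal η := fun X hX =>
      (measure_deviationEvent_le hnpos X.bounded hε0 (hcard X hX)).trans
        (ENNReal.ofReal_le_ofReal (union_bound_le hH hd hδ hδH hnN))
    refine ⟨isSound_lsvi_of_suboptimality_le fun X hX => ?_,
      isGloballySound_lsvi (B := δ / 2) (η := η) (by positivity) hη0 (by linarith) (by linarith)
        fun X hX => ⟨_, measurableSet_deviationEvent _ _ _ _ _ ε, hbad X hX, fun ω hω => ?_⟩,
      fun _ => ?_⟩
    · have h := suboptimality_lsvi_le (τ := τ) hd (hD X hX) hε0 hη0 (hbad X hX)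
      rwa [hB, hHHη, add_halves] at h
    · have h := greedyGap_le (τ := τ) hd (hD X hX) hε0 hω
      rwa [hB] at h
    · exact queryCost_lsvi_le fun X hX =>
        (lastRound_add_one_le hnpos hH hm1 (hcard X hX)).trans
          (total_queries_le hH hd hδ hδH hnN1)
  · refine ⟨isSound_lsvi_of_suboptimality_le fun X _ =>
      (MDP.suboptimality_le_horizon X.bounded (isPolicy_lsvi X D τ n) H).trans
        (ENNReal.ofReal_le_ofReal hδH.le),
      -- No exceptional event is needed here.
      isGloballySound_lsvi (B := H) (η := 0) (by positivity) le_rfl (by linarith) (by linarith)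
        fun X _ => ⟨∅, MeasurableSet.empty, by simp, fun ω _ => greedyGap_le_horizon X D τ n ω⟩,
      fun h => absurd h (not_le.2 hδH)⟩
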